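/- **Setting.** Let $q\ge 1$ be an integer, let $e^1,\dots,e^q$ be the standard basis of $\mathbb R^q$, $\Lambda=\{e^1,\dots,e^q\}$, $\mathcal P=\{z\in\mathbb R^q: z_k\ge 0,\ \sum_k z_k=1\}$ and $\|z\|_1=\sum_k|z_k|$. For $\omega\in\Lambda^n$ let $L_n(\omega)=\frac1n\sum_{i=1}^n\omega_i\in\mathcal P$. Let $H:\mathbb R^q\to\mathbb R$ be a concave $C^3$ function of the form $H(z)=\sum_{k=1}^q H_k(z_k)$, and let $\beta>0$. The Gibbs measure on $\Lambda^n$ is $$P_{n,\beta}(\omega)=\frac1{Z_n(\beta)}\,e^{-\beta nH(L_n(\omega))}\,P_n(\omega),$$ where $P_n$ is the product of $n$ copies of the uniform law on $\Lambda$ and $Z_n(\beta)$ is the normalizing constant. The Glauber dynamics is the Markov chain on $\Lambda^n$ that at each step selects a vertex $i\in\{1,\dots,n\}$ uniformly and resamples the spin at $i$ from $P_{n,\beta}$ conditioned on all the other spins. Let $P^t(\sigma,\cdot)$ be its $t$-step transition probabilities, $d_n(t)=\max_\sigma\|P^t(\sigma,\cdot)-P_{n,\beta}\|_{TV}$, and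 $t_{mix}(\epsilon)=t_{mix}(\epsilon,n)=\min\{t: d_n(t)\le\epsilon\}$. Assume that $\nu\mapsto\sum_k\nu_k\log(q\,\nu_k)+\beta H(\nu)$ has exactly one minimizer $z_\beta$ on $\mathcal P$. Put $$g_k(z)=\frac{e^{-\beta\,\partial_kH(z)}}{\sum_{l=1}^q e^{-\beta\,\partial_lH(z)}},\qquad g=(g_1,\dots,g_q).$$ For $\delta\in(0,1)$, a *neo-geodesic family* $\mathbf{NG}_\delta$ consists of one $C^1$ curve $\rho_z:[0,1]\to\mathcal P$ for each $z\in\mathcal P$, $z\ne z_\beta$, with $\rho_z(0)=z_\beta$ and $\rho_z(1)=z$, monotone in each coordinate, such that $$\frac{1}{\|z-z_\beta\|_1}\sum_{k=1}^q\int_0^1\big|\langle\nabla g_k(\rho_z(t)),\rho_z'(t)\rangle\big|\,dt\le 1-\frac\delta2 .$$ **Condition RS.** There are $\delta\in(0,1)$ and $\varepsilon_0>0$ such that for every $\varepsilon\in(0,\varepsilon_0)$ there is a neo-geodesic family $\mathbf{NG}_\delta$ with the following property: for each $z\in\mathcal P$ with $\|z-z_\beta\|_1\ge\varepsilon$ there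 are $0=t_0\le t_1\le\dots\le t_r=1$ such that the points $z_i=\rho_z(t_i)$ satisfy $\varepsilon\le\|z_i-z_{i-1}\|_1<2\varepsilon$ for $i=1,\dots,r$ and $$\frac{\sum_{k=1}^q\sum_{i=1}^r\big|\langle z_i-z_{i-1},\nabla g_k(z_{i-1})\rangle\big|}{\|z-z_\beta\|_1}\le 1-\frac\delta3 .$$ **Local contraction condition.** $$\limsup_{z\to z_\beta,\ z\in\mathcal P\setminus\{z_\beta\}}\frac{\|g(z)-g(z_\beta)\|_1}{\|z-z_\beta\|_1}<1 .$$ **Theorem.** If Condition RS and the local contraction condition hold, then the mixing time of the Glauber dynamics satisfies $t_{mix}=O(n\log n)$. That is, for every $\epsilon>0$, $t_{mix}(\epsilon,n)$ is defined for all sufficiently large $n$, and $t_{mix}(\epsilon,n)=O(n\log n)$ as $n\to\infty$. -/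

import Mathlib

open Set Filter Topology Asymptotics

namespace MeanFieldGibbs

noncomputable section

/-- The `ℓ¹` norm on `ℝ^q` (the type `Fin q → ℝ` itself carries the sup norm). -/
def l1 {q : ℕ} (z : Fin q → ℝ) : ℝ := ∑ k, |z k|

/-- A configuration of `n` spins.  The spin value `e^k` is recorded by its index `k`. -/
abbrev Config (q n : ℕ) : Type := Fin n → Fin q

/-- The magnetization vector `L_n(ω)`: its `k`-th entry is the proportion of spins equal to `e^k`.
It lies in the simplex `stdSimplex ℝ (Fin q)`. -/
def magnetization {q n : ℕ} (ω : Config q n) : Fin q → ℝ :=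
  fun k => (1 / (n : ℝ)) * ∑ i, if ω i = k then 1 else 0

/-- The uniform law of a single spin. -/
def prior (q : ℕ) (_k : Fin q) : ℝ := 1 / (q : ℝ)

/-- The product measure `P_n` with marginals `prior`, as a mass function. -/
def productMass {q n : ℕ} (ω : Config q n) : ℝ := ∏ i, prior q (ω i)

/-- The Hamiltonian `H_n(ω) = n H(L_n(ω))`. -/
def hamiltonian {q : ℕ} (H : (Fin q → ℝ) → ℝ) {n : ℕ} (ω : Config q n) : ℝ :=
  n * H (magnetization ω)

/-- The partition function `Z_n(β)`. -/
def partitionFunction {q : ℕ} (H : (Fin q → ℝ) → ℝ) (β : ℝ) (n : ℕ) : ℝ :=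
  ∑ ω : Config q n, Real.exp (-β * hamiltonian H ω) * productMass ω

/-- The Gibbs measure `P_{n,β}`, as a mass function on configurations. -/
def gibbsMass {q : ℕ} (H : (Fin q → ℝ) → ℝ) (β : ℝ) {n : ℕ} (ω : Config q n) : ℝ :=
  Real.exp (-β * hamiltonian H ω) * productMass ω / partitionFunction H β n

/-- The relative entropy `R(ν | ρ)` with respect to the uniform law `ρ` (with `0 log 0 = 0`). -/
def relEntropy {q : ℕ} (ν : Fin q → ℝ) : ℝ := ∑ k, ν k * Real.log (ν k / prior q k)

/-- The set of equilibrium macrostates: the minimizers over the simplex of `R(ν | ρ) + β H(ν)`. -/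
def equilibriumMacrostates {q : ℕ} (H : (Fin q → ℝ) → ℝ) (β : ℝ) : Set (Fin q → ℝ) :=
  {ν | ν ∈ stdSimplex ℝ (Fin q) ∧
    IsMinOn (fun μ => relEntropy μ + β * H μ) (stdSimplex ℝ (Fin q)) ν}

/-- The probability that, when vertex `i` of `σ` is selected, its spin is updated to `e^k`: the
Gibbs measure conditioned on the spins at all the other vertices. -/
def updateProb {q : ℕ} (H : (Fin q → ℝ) → ℝ) (β : ℝ) {n : ℕ}
    (σ : Config q n) (i : Fin n) (k : Fin q) : ℝ :=
  gibbsMass H β (Function.update σ i k) / ∑ l, gibbsMass H β (Function.update σ i l)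

/-- The transition matrix of the Glauber dynamics: select a vertex uniformly and update its spin. -/
def glauber {q : ℕ} (H : (Fin q → ℝ) → ℝ) (β : ℝ) (n : ℕ) :
    Matrix (Config q n) (Config q n) ℝ :=
  Matrix.of fun σ τ => ∑ i : Fin n, (1 / (n : ℝ)) *
    ∑ k : Fin q, if τ = Function.update σ i k then updateProb H β σ i k else 0

/-- Total variation distance of two mass functions on a finite set. -/
def tvDist {Ω : Type*} [Fintype Ω] (μ ν : Ω → ℝ) : ℝ := (1 / 2) * ∑ x, |μ x - ν x|

/-- The maximal distance to stationarity `d(t)` of the Glauber dynamics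
(the supremum is over a finite set). -/
def maxDist {q : ℕ} (H : (Fin q → ℝ) → ℝ) (β : ℝ) (n t : ℕ) : ℝ :=
  ⨆ σ : Config q n, tvDist ((glauber H β n ^ t) σ) (gibbsMass H β)

/-- The mixing time `min {t : d(t) ≤ ε}` of the Glauber dynamics; it has this meaning as soon as
some `t` with `d(t) ≤ ε` exists. -/
def mixingTime {q : ℕ} (H : (Fin q → ℝ) → ℝ) (β : ℝ) (ε : ℝ) (n : ℕ) : ℕ :=
  sInf {t | maxDist H β n t ≤ ε}

/-- The partial derivative `∂_k H`. -/
def partialDeriv {q : ℕ} (H : (Fin q → ℝ) → ℝ) (k : Fin q) (z : Fin q → ℝ) : ℝ :=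
  fderiv ℝ H z (Pi.single k 1)

/-- The function `g^{H,β}`, whose `k`-th coordinate is the `k`-th partial derivative of the
logarithmic moment generating function of a single spin, evaluated at `-β ∇H(z)`. -/
def g {q : ℕ} (H : (Fin q → ℝ) → ℝ) (β : ℝ) (z : Fin q → ℝ) (k : Fin q) : ℝ :=
  Real.exp (-β * partialDeriv H k z) / ∑ l, Real.exp (-β * partialDeriv H l z)

/-- The pairing `⟨v, ∇ g_k(y)⟩`, i.e. the directional derivative of `g_k` at `y` along `v`. -/
def gradPairing {q : ℕ} (H : (Fin q → ℝ) → ℝ) (β : ℝ) (k : Fin q) (y v : Fin q → ℝ) : ℝ :=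
  fderiv ℝ (fun z => g H β z k) y v

/-- The aggregate `g`-variation `∑_k ∫_ρ |⟨∇ g_k(y), dy⟩|` along a `C¹` curve
`ρ : [0,1] → ℝ^q`. -/
def aggregateVariation {q : ℕ} (H : (Fin q → ℝ) → ℝ) (β : ℝ) (ρ : ℝ → Fin q → ℝ) : ℝ :=
  ∑ k, ∫ t in (0 : ℝ)..1, |gradPairing H β k (ρ t) (derivWithin ρ (Icc 0 1) t)|

/-- `ρ`, restricted to `[0,1]`, is a `C¹` curve in the simplex from `x` to `z` that is monotone
(nondecreasing or nonincreasing) in each coordinate. -/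
structure IsMonotoneCurve {q : ℕ} (x z : Fin q → ℝ) (ρ : ℝ → Fin q → ℝ) : Prop where
  smooth : ContDiffOn ℝ 1 ρ (Icc 0 1)
  mem_simplex : ∀ t ∈ Icc (0 : ℝ) 1, ρ t ∈ stdSimplex ℝ (Fin q)
  source : ρ 0 = x
  target : ρ 1 = z
  monotone : ∀ k, MonotoneOn (fun t => ρ t k) (Icc 0 1) ∨ AntitoneOn (fun t => ρ t k) (Icc 0 1)

/-- A neo-geodesic family with parameter `δ`: for each `z ≠ z_β` of the simplex one smooth monotone
curve `ρ z` from `z_β` to `z`, whose aggregate `g`-variation is at most `(1 - δ/2) ‖z - z_β‖₁`. -/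
def IsNeoGeodesicFamily {q : ℕ} (H : (Fin q → ℝ) → ℝ) (β : ℝ) (zβ : Fin q → ℝ) (δ : ℝ)
    (ρ : (Fin q → ℝ) → ℝ → Fin q → ℝ) : Prop :=
  ∀ z ∈ stdSimplex ℝ (Fin q), z ≠ zβ →
    IsMonotoneCurve zβ z (ρ z) ∧ aggregateVariation H β (ρ z) / l1 (z - zβ) ≤ 1 - δ / 2

/-- The Riemann sum condition.  For all small enough `ε > 0` there is a neo-geodesic family such
that on each of its curves ending at distance at least `ε` from `z_β` there are successive points
`z_i = ρ_z(t_i)`, `z_0 = z_β`, `z_r = z`, with `ℓ¹` step sizes in `[ε, 2ε)`, along which the Riemann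
sum of the aggregate `g`-variation is at most `(1 - δ/3) ‖z - z_β‖₁`. -/
def ConditionRS {q : ℕ} (H : (Fin q → ℝ) → ℝ) (β : ℝ) (zβ : Fin q → ℝ) : Prop :=
  ∃ δ ∈ Ioo (0 : ℝ) 1, ∃ ε₀ > 0, ∀ ε ∈ Ioo 0 ε₀,
    ∃ ρ : (Fin q → ℝ) → ℝ → Fin q → ℝ, IsNeoGeodesicFamily H β zβ δ ρ ∧
      ∀ z ∈ stdSimplex ℝ (Fin q), ε ≤ l1 (z - zβ) →
        ∃ (r : ℕ) (t : Fin (r + 1) → ℝ), Monotone t ∧ t 0 = 0 ∧ t (Fin.last r) = 1 ∧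
          (∀ i : Fin r, l1 (ρ z (t i.succ) - ρ z (t i.castSucc)) ∈ Ico ε (2 * ε)) ∧
          (∑ k, ∑ i : Fin r, |gradPairing H β k (ρ z (t i.castSucc))
              (ρ z (t i.succ) - ρ z (t i.castSucc))|) / l1 (z - zβ) ≤ 1 - δ / 3

/-- The local contraction condition:
`limsup_{z → z_β} ‖g(z) - g(z_β)‖₁ / ‖z - z_β‖₁ < 1`, where `z` ranges over the points of the
simplex other than `z_β`; the `limsup` is taken in the extended reals. -/
def ConditionLocalBound {q : ℕ} (H : (Fin q → ℝ) → ℝ) (β : ℝ) (zβ : Fin q → ℝ) : Prop :=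
  limsup (fun z => ((l1 (g H β z - g H β zβ) / l1 (z - zβ) : ℝ) : EReal))
    (𝓝[stdSimplex ℝ (Fin q) \ {zβ}] zβ) < 1

end

end MeanFieldGibbs

open MeanFieldGibbs

/-! Couple a chain from an arbitrary configuration with a stationary one, updating the same vertex
in both and coupling the two new spins maximally (`exists_glauber_coupling`). The expected Hamming
distance drops by a factor `1 - c/n` in one step as soon as the two update laws differ, in total
variation, by at most `1 - c` times the proportion of disagreeing vertices.

This holds whenever the stationary copy has magnetization near `zβ`, wherever the other copy is
(`exists_contraction`). The update law is a softmax of difference quotients of `H` with step `1/n`,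
hence close to `g`. Integrating along neo-geodesics gives `‖g z - g zβ‖₁ ≤ (1 - δ/2) ‖z - zβ‖₁` on
the whole simplex, which settles the case of a distant first copy. As `zβ` is interior, the same
inequality bounds the tangential derivative of `g` at `zβ`, which settles the case of two copies
near `zβ`.

The stationary copy strays from `zβ` with probability exponentially small in `n`
(`exists_gibbsMass_far_le`), by Jensen's inequality for the partition function and the method of
types. The union of these events over `O(n log n)` steps is negligible, while `(1 - c/n)^t n`
becomes small (`tvDist_pow_le_of_contraction`, `exists_mixing_bound`). -/

namespace MeanFieldGibbs

/-! ### Couplings and contraction for finite Markov chains -/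

/-- Two mass functions of the same total mass have a coupling whose off-diagonal mass is their total
variation distance. -/
theorem exists_maximal_coupling {κ : Type*} [Fintype κ] [DecidableEq κ] (p r : κ → ℝ)
    (hp : ∀ k, 0 ≤ p k) (hr : ∀ k, 0 ≤ r k) (hpr : ∑ k, p k = ∑ k, r k) :
    ∃ m : κ → κ → ℝ, (∀ k l, 0 ≤ m k l) ∧ (∀ k, ∑ l, m k l = p k) ∧ (∀ l, ∑ k, m k l = r l) ∧
      ∑ k, ∑ l, (if k = l then 0 else m k l) = tvDist p r := by
  set u : κ → ℝ := fun k => max (p k - r k) 0 with hu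
  set v : κ → ℝ := fun k => max (r k - p k) 0 with hv
  have hu0 : ∀ k, 0 ≤ u k := fun k => le_max_right _ _
  have hv0 : ∀ k, 0 ≤ v k := fun k => le_max_right _ _
  have hsub : ∀ k, u k - v k = p k - r k := by
    intro k
    simp only [hu, hv]
    rcases le_total (p k) (r k) with h | h
    · rw [max_eq_right (by linarith), max_eq_left (by linarith)]; ring
    · rw [max_eq_left (by linarith), max_eq_right (by linarith)]; ring
  have hadd : ∀ k, u k + v k = |p k - r k| := by
    intro k
    simp only [hu, hv]
    rcases le_total (p k) (r k) with h | h
    · rw [max_eq_right (by linarith), max_eq_left (by linarith), abs_of_nonpos (by linarith)]; ring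
    · rw [max_eq_left (by linarith), max_eq_right (by linarith), abs_of_nonneg (by linarith)]; ring
  have hmul : ∀ k, u k * v k = 0 := by
    intro k
    simp only [hu, hv]
    rcases le_total (p k) (r k) with h | h
    · rw [max_eq_right (by linarith), zero_mul]
    · rw [max_eq_right (a := r k - p k) (by linarith), mul_zero]
  have huv : ∑ k, u k = ∑ k, v k := by
    have : ∑ k, (u k - v k) = 0 := by simp [hsub, hpr]
    rw [Finset.sum_sub_distrib] at this
    linarith
  set T : ℝ := ∑ k, u k with hT
  have hTtv : T = tvDist p r := by
    have : ∑ k, |p k - r k| = T + T := by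
      simp_rw [← hadd]
      rw [Finset.sum_add_distrib, ← huv]
    rw [tvDist, this]; ring
  -- When `T = 0` every `u k` vanishes, so the convention `x / 0 = 0` does no harm.
  have hTu : ∀ k, u k * T / T = u k := by
    intro k
    by_cases h : T = 0
    · have := (Finset.sum_eq_zero_iff_of_nonneg (fun i _ => hu0 i)).1 h k (Finset.mem_univ k)
      simp [this]
    · field_simp
  have hTv : ∀ k, T * v k / T = v k := by
    intro k
    by_cases h : T = 0
    · have := (Finset.sum_eq_zero_iff_of_nonneg (fun i _ => hv0 i)).1 (huv ▸ h) k (Finset.mem_univ k)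
      simp [this]
    · field_simp
  have hTT : T * T / T = T := mul_self_div_self T
  have hT0 : 0 ≤ T := Finset.sum_nonneg fun k _ => hu0 k
  -- The common part `min (p k) (r k) = p k - u k` sits on the diagonal; the excesses `u` and `v`
  -- are coupled independently. By `hmul` this second part has no diagonal mass.
  refine ⟨fun k l => (if k = l then p k - u k else 0) + u k * v l / T, ?_, ?_, ?_, ?_⟩
  · intro k l
    have h1 : 0 ≤ p k - u k := by
      simp only [hu]
      rcases le_total (p k) (r k) with h | h
      · rw [max_eq_right (by linarith)]; linarith [hp k]
      · rw [max_eq_left (by linarith)]; linarith [hr k]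
    have h2 : 0 ≤ u k * v l / T := div_nonneg (mul_nonneg (hu0 k) (hv0 l)) hT0
    dsimp only
    split_ifs <;> linarith
  · intro k
    rw [Finset.sum_add_distrib, Finset.sum_ite_eq, ← Finset.sum_div, ← Finset.mul_sum, ← huv, hTu]
    simp
  · intro l
    rw [Finset.sum_add_distrib, Finset.sum_ite_eq', ← Finset.sum_div, ← Finset.sum_mul, ← hT, hTv]
    simp only [Finset.mem_univ, if_true]
    linarith [hsub l]
  · rw [← hTtv]
    have : ∀ k l, (if k = l then 0 else (if k = l then p k - u k else 0) + u k * v l / T)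
        = u k * v l / T := by
      intro k l
      split_ifs with h
      · subst h; simp [hmul]
      · simp
    simp_rw [this, ← Finset.sum_div, ← Finset.mul_sum, ← huv, ← Finset.sum_mul, ← hT, hTT]

/-- A coupling bounds the total variation distance of its marginals by its off-diagonal mass. -/
theorem tvDist_le_of_coupling {κ : Type*} [Fintype κ] [DecidableEq κ] (m : κ → κ → ℝ)
    (hm : ∀ k l, 0 ≤ m k l) (p r : κ → ℝ) (hp : ∀ k, ∑ l, m k l = p k)
    (hr : ∀ l, ∑ k, m k l = r l) :
    tvDist p r ≤ ∑ k, ∑ l, (if k = l then 0 else m k l) := by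
  have key : ∀ x, |p x - r x| ≤
      ∑ l, (if x = l then 0 else m x l) + ∑ l, (if l = x then 0 else m l x) := by
    intro x
    have h1 : p x = m x x + ∑ l, (if x = l then 0 else m x l) := by
      rw [← hp, ← Finset.add_sum_erase _ _ (Finset.mem_univ x),
        ← Finset.add_sum_erase _ (fun l => if x = l then 0 else m x l) (Finset.mem_univ x)]
      simp only [if_true, zero_add]
      congr 1
      exact Finset.sum_congr rfl fun l hl => by rw [if_neg (Finset.ne_of_mem_erase hl).symm]
    have h2 : r x = m x x + ∑ l, (if l = x then 0 else m l x) := by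
      rw [← hr, ← Finset.add_sum_erase _ _ (Finset.mem_univ x),
        ← Finset.add_sum_erase _ (fun l => if l = x then 0 else m l x) (Finset.mem_univ x)]
      simp only [if_true, zero_add]
      congr 1
      exact Finset.sum_congr rfl fun l hl => by rw [if_neg (Finset.ne_of_mem_erase hl)]
    have h3 : 0 ≤ ∑ l, (if x = l then 0 else m x l) :=
      Finset.sum_nonneg fun l _ => by split_ifs <;> simp [hm]
    have h4 : 0 ≤ ∑ l, (if l = x then 0 else m l x) :=
      Finset.sum_nonneg fun l _ => by split_ifs <;> simp [hm]
    rw [abs_le]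
    constructor <;> linarith
  have : ∑ x, |p x - r x| ≤ 2 * ∑ k, ∑ l, (if k = l then 0 else m k l) := by
    refine (Finset.sum_le_sum fun x _ => key x).trans ?_
    rw [Finset.sum_add_distrib, two_mul]
    exact add_le_add le_rfl (le_of_eq Finset.sum_comm)
  rw [tvDist]
  linarith

/-- Distance to stationarity of a finite Markov chain, from a one-step coupling that contracts the
distance `d` whenever the second coordinate is in the set `G`. -/
theorem tvDist_pow_le_of_contraction {Ω : Type*} [Fintype Ω] [DecidableEq Ω]
    (P : Matrix Ω Ω ℝ) (π : Ω → ℝ) (hπ0 : ∀ x, 0 ≤ π x) (hπ1 : ∑ x, π x = 1)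
    (hπP : ∀ y, ∑ x, π x * P x y = π y) (d : Ω → Ω → ℝ) (D a : ℝ)
    (hd0 : ∀ x y, 0 ≤ d x y) (hd1 : ∀ x y, x ≠ y → 1 ≤ d x y) (hdD : ∀ x y, d x y ≤ D)
    (ha0 : 0 ≤ a) (ha1 : a ≤ 1) (G : Set Ω) [DecidablePred (· ∈ G)]
    (Q : Ω → Ω → Ω → Ω → ℝ) (hQ0 : ∀ x y x' y', 0 ≤ Q x y x' y')
    (hQ1 : ∀ x y x', ∑ y', Q x y x' y' = P x x') (hQ2 : ∀ x y y', ∑ x', Q x y x' y' = P y y')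
    (hP : ∀ x, ∑ x', P x x' = 1)
    (hQd : ∀ x y, y ∈ G → ∑ x', ∑ y', Q x y x' y' * d x' y' ≤ (1 - a) * d x y)
    (x₀ : Ω) (t : ℕ) :
    tvDist ((P ^ t) x₀) π ≤ (1 - a) ^ t * D + t * (D * ∑ y, if y ∈ G then 0 else π y) := by
  have hQD : ∀ x y, ∑ x', ∑ y', Q x y x' y' * d x' y' ≤ D := by
    intro x y
    calc ∑ x', ∑ y', Q x y x' y' * d x' y' ≤ ∑ x', ∑ y', Q x y x' y' * D := by
          gcongr with x' _ y' _
          · exact hQ0 x y x' y'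
          · exact hdD _ _
      _ = D := by simp_rw [← Finset.sum_mul, hQ1, hP, one_mul]
  have hD0 : 0 ≤ D := (hd0 x₀ x₀).trans (hdD x₀ x₀)
  have hb0 : ∀ y, 0 ≤ (if y ∈ G then 0 else π y) := fun y => by split_ifs <;> simp [hπ0]
  -- The induction carries a coupling at time `t` whose second marginal is exactly `π`; stationarity
  -- is what makes the mass outside `G` the same at every step.
  suffices h : ∃ μ : Ω → Ω → ℝ, (∀ x y, 0 ≤ μ x y) ∧ (∀ x, ∑ y, μ x y = (P ^ t) x₀ x) ∧
      (∀ y, ∑ x, μ x y = π y) ∧ ∑ x, ∑ y, μ x y * d x y ≤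
        (1 - a) ^ t * D + t * (D * ∑ y, if y ∈ G then 0 else π y) by
    obtain ⟨μ, h0, h1, h2, h3⟩ := h
    refine (tvDist_le_of_coupling μ h0 _ _ h1 h2).trans (le_trans ?_ h3)
    gcongr with x _ y _
    split_ifs with hxy
    · exact mul_nonneg (h0 _ _) (hd0 _ _)
    · exact le_mul_of_one_le_right (h0 _ _) (hd1 _ _ hxy)
  induction t with
  | zero =>
    refine ⟨fun x y => (if x = x₀ then 1 else 0) * π y, ?_, ?_, ?_, ?_⟩
    · intro x y
      dsimp only
      split_ifs <;> simp [hπ0]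
    · intro x
      rw [← Finset.mul_sum, hπ1, mul_one, pow_zero, Matrix.one_apply]
      simp [eq_comm]
    · intro y
      simp
    · calc ∑ x, ∑ y, (if x = x₀ then 1 else 0) * π y * d x y
          ≤ ∑ x, ∑ y, (if x = x₀ then 1 else 0) * π y * D := by
            gcongr with x _ y _
            · split_ifs <;> simp [hπ0]
            · exact hdD _ _
        _ = D := by simp [← Finset.sum_mul, hπ1]
        _ ≤ _ := by simp
  | succ t ih =>
    obtain ⟨μ, h0, h1, h2, h3⟩ := ih
    refine ⟨fun x' y' => ∑ x, ∑ y, μ x y * Q x y x' y', ?_, ?_, ?_, ?_⟩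
    · intro x' y'
      exact Finset.sum_nonneg fun x _ => Finset.sum_nonneg fun y _ =>
        mul_nonneg (h0 _ _) (hQ0 _ _ _ _)
    · intro x'
      calc ∑ y', ∑ x, ∑ y, μ x y * Q x y x' y' = ∑ x, ∑ y', ∑ y, μ x y * Q x y x' y' :=
            Finset.sum_comm
        _ = ∑ x, ∑ y, ∑ y', μ x y * Q x y x' y' :=
            Finset.sum_congr rfl fun _ _ => Finset.sum_comm
        _ = ∑ x, (P ^ t) x₀ x * P x x' := by
            simp_rw [← Finset.mul_sum, hQ1, ← Finset.sum_mul]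
            exact Finset.sum_congr rfl fun x _ => by rw [h1]
        _ = (P ^ (t + 1)) x₀ x' := by rw [pow_succ, Matrix.mul_apply]
    · intro y'
      calc ∑ x', ∑ x, ∑ y, μ x y * Q x y x' y' = ∑ x, ∑ x', ∑ y, μ x y * Q x y x' y' :=
            Finset.sum_comm
        _ = ∑ x, ∑ y, ∑ x', μ x y * Q x y x' y' :=
            Finset.sum_congr rfl fun _ _ => Finset.sum_comm
        _ = ∑ y, ∑ x, μ x y * P y y' := by
            simp_rw [← Finset.mul_sum, hQ2]
            exact Finset.sum_comm
        _ = π y' := by simp_rw [← Finset.sum_mul, h2, hπP]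
    · have e1 : ∑ x', ∑ y', (∑ x, ∑ y, μ x y * Q x y x' y') * d x' y' =
          ∑ x, ∑ y, μ x y * ∑ x', ∑ y', Q x y x' y' * d x' y' := by
        simp_rw [Finset.sum_mul, Finset.mul_sum]
        calc _ = ∑ x', ∑ x, ∑ y', ∑ y, μ x y * Q x y x' y' * d x' y' :=
              Finset.sum_congr rfl fun _ _ => Finset.sum_comm
          _ = ∑ x, ∑ x', ∑ y', ∑ y, μ x y * Q x y x' y' * d x' y' := Finset.sum_comm
          _ = ∑ x, ∑ x', ∑ y, ∑ y', μ x y * Q x y x' y' * d x' y' :=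
              Finset.sum_congr rfl fun _ _ => Finset.sum_congr rfl fun _ _ => Finset.sum_comm
          _ = ∑ x, ∑ y, ∑ x', ∑ y', μ x y * Q x y x' y' * d x' y' :=
              Finset.sum_congr rfl fun _ _ => Finset.sum_comm
          _ = _ := by simp_rw [mul_assoc]
      rw [e1]
      -- Inside `G` the distance contracts; outside, only the diameter bound `D` is available.
      have e2 : ∀ x y, μ x y * ∑ x', ∑ y', Q x y x' y' * d x' y' ≤
          (1 - a) * (μ x y * d x y) + D * (if y ∈ G then 0 else μ x y) := by
        intro x y
        by_cases hy : y ∈ G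
        · have := mul_le_mul_of_nonneg_left (hQd x y hy) (h0 x y)
          simp only [hy, if_true]
          linarith
        · have h4 := mul_le_mul_of_nonneg_left (hQD x y) (h0 x y)
          have h5 : 0 ≤ (1 - a) * (μ x y * d x y) :=
            mul_nonneg (by linarith) (mul_nonneg (h0 _ _) (hd0 _ _))
          simp only [hy, if_false]
          linarith
      refine (Finset.sum_le_sum fun x _ => Finset.sum_le_sum fun y _ => e2 x y).trans ?_
      have e3 : ∑ x, ∑ y, (if y ∈ G then 0 else μ x y) = ∑ y, if y ∈ G then 0 else π y := by
        rw [Finset.sum_comm]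
        refine Finset.sum_congr rfl fun y _ => ?_
        split_ifs
        · simp
        · exact h2 y
      simp_rw [Finset.sum_add_distrib, ← Finset.mul_sum]
      rw [e3]
      have e4 := mul_le_mul_of_nonneg_left h3 (show 0 ≤ 1 - a by linarith)
      -- The factor `1 - a` is dropped from the errors already accumulated, so they add up linearly
      -- in `t`.
      have e5 : 0 ≤ a * (t * (D * ∑ y, if y ∈ G then 0 else π y)) :=
        mul_nonneg ha0 (mul_nonneg (Nat.cast_nonneg _)
          (mul_nonneg hD0 (Finset.sum_nonneg fun y _ => hb0 y)))
      push_cast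
      rw [pow_succ]
      linarith

/-! ### Softmax, difference quotients and the `ℓ¹` norm -/

/-- The Gibbs law on the spin values with energies `a` at inverse temperature `β`. -/
noncomputable def softmax {q : ℕ} (β : ℝ) (a : Fin q → ℝ) (k : Fin q) : ℝ :=
  Real.exp (-β * a k) / ∑ l, Real.exp (-β * a l)

/-- The forward difference quotients of `H` along the coordinate directions. -/
noncomputable def forwardQuotient {q : ℕ} (H : (Fin q → ℝ) → ℝ) (s : ℝ) (x : Fin q → ℝ)
    (k : Fin q) : ℝ :=
  (H (x + Pi.single k s) - H x) / s

/-- The contribution to the magnetization of the spins at the vertices other than `i`. -/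
noncomputable def offMagnetization {q n : ℕ} (σ : Config q n) (i : Fin n) : Fin q → ℝ :=
  magnetization σ - Pi.single (σ i) (1 / (n : ℝ))

section l1

variable {q : ℕ}

theorem l1_nonneg (z : Fin q → ℝ) : 0 ≤ l1 z := Finset.sum_nonneg fun _ _ => abs_nonneg _

theorem l1_add_le (z w : Fin q → ℝ) : l1 (z + w) ≤ l1 z + l1 w := by
  rw [l1, l1, l1, ← Finset.sum_add_distrib]
  exact Finset.sum_le_sum fun k _ => abs_add_le _ _

theorem l1_neg (z : Fin q → ℝ) : l1 (-z) = l1 z := by simp [l1]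

theorem l1_sub_comm (z w : Fin q → ℝ) : l1 (z - w) = l1 (w - z) := by
  rw [← l1_neg, neg_sub]

theorem l1_sub_le (x y z : Fin q → ℝ) : l1 (x - z) ≤ l1 (x - y) + l1 (y - z) := by
  simpa using l1_add_le (x - y) (y - z)

theorem l1_smul (c : ℝ) (z : Fin q → ℝ) : l1 (c • z) = |c| * l1 z := by
  simp [l1, abs_mul, Finset.mul_sum]

theorem norm_le_l1 (z : Fin q → ℝ) : ‖z‖ ≤ l1 z :=
  (pi_norm_le_iff_of_nonneg (l1_nonneg z)).2 fun k =>
    Finset.single_le_sum (f := fun k => |z k|) (fun _ _ => abs_nonneg _) (Finset.mem_univ k)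

theorem l1_le_card_mul_norm (z : Fin q → ℝ) : l1 z ≤ q * ‖z‖ := by
  calc l1 z ≤ ∑ _k : Fin q, ‖z‖ := Finset.sum_le_sum fun k _ => norm_le_pi_norm z k
    _ = q * ‖z‖ := by simp

theorem l1_single (k : Fin q) (c : ℝ) : l1 (Pi.single k c) = |c| := by
  rw [l1, Finset.sum_eq_single k] <;> simp +contextual

theorem continuous_l1 : Continuous (l1 : (Fin q → ℝ) → ℝ) := by
  unfold l1
  fun_prop

end l1

/-! ### Magnetization and Hamming distance -/

section magnetization

variable {q n : ℕ}

theorem magnetization_update (σ : Config q n) (i : Fin n) (k : Fin q) :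
    magnetization (Function.update σ i k) = offMagnetization σ i + Pi.single k (1 / (n : ℝ)) := by
  funext l
  simp only [magnetization, offMagnetization, Pi.add_apply, Pi.sub_apply]
  rw [← Finset.add_sum_erase _ _ (Finset.mem_univ i),
    ← Finset.add_sum_erase _ (fun j => if σ j = l then (1 : ℝ) else 0) (Finset.mem_univ i)]
  have : ∑ j ∈ Finset.univ.erase i, (if Function.update σ i k j = l then (1 : ℝ) else 0) =
      ∑ j ∈ Finset.univ.erase i, (if σ j = l then (1 : ℝ) else 0) :=
    Finset.sum_congr rfl fun j hj => by rw [Function.update_of_ne (Finset.ne_of_mem_erase hj)]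
  rw [this, Function.update_self, Pi.single_apply, Pi.single_apply]
  by_cases h1 : k = l <;> by_cases h2 : σ i = l <;> simp [h1, h2, eq_comm] <;> ring_nf <;>
    simp_all [eq_comm]

theorem hammingDist_cast (σ τ : Config q n) :
    (hammingDist σ τ : ℝ) = ∑ i, if σ i = τ i then 0 else 1 := by
  simp only [hammingDist, Finset.card_filter]
  push_cast
  exact Finset.sum_congr rfl fun i _ => by simp [ite_not]

theorem hammingDist_update (σ τ : Config q n) (i : Fin n) (k l : Fin q) :
    (hammingDist (Function.update σ i k) (Function.update τ i l) : ℝ) =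
      hammingDist σ τ - (if σ i = τ i then 0 else 1) + (if k = l then 0 else 1) := by
  rw [hammingDist_cast, hammingDist_cast, ← Finset.add_sum_erase _ _ (Finset.mem_univ i),
    ← Finset.add_sum_erase _ (fun j => if σ j = τ j then (0 : ℝ) else 1) (Finset.mem_univ i)]
  have : ∑ j ∈ Finset.univ.erase i,
      (if Function.update σ i k j = Function.update τ i l j then (0 : ℝ) else 1) =
      ∑ j ∈ Finset.univ.erase i, (if σ j = τ j then (0 : ℝ) else 1) :=
    Finset.sum_congr rfl fun j hj => by
      rw [Function.update_of_ne (Finset.ne_of_mem_erase hj),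
        Function.update_of_ne (Finset.ne_of_mem_erase hj)]
  rw [this]
  simp only [Function.update_self]
  ring

theorem l1_magnetization_sub_le (σ τ : Config q n) :
    l1 (magnetization σ - magnetization τ) ≤ 2 * hammingDist σ τ / n := by
  have h1 : ∀ k, |(magnetization σ - magnetization τ) k| ≤
      (1 / (n : ℝ)) * ∑ i, |(if σ i = k then (1 : ℝ) else 0) - (if τ i = k then 1 else 0)| := by
    intro k
    simp only [magnetization, Pi.sub_apply]
    rw [← mul_sub, ← Finset.sum_sub_distrib, abs_mul, abs_of_nonneg (by positivity)]
    gcongr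
    exact Finset.abs_sum_le_sum_abs _ _
  have h2 : ∀ i, ∑ k, |(if σ i = k then (1 : ℝ) else 0) - (if τ i = k then 1 else 0)| ≤
      2 * (if σ i = τ i then 0 else 1) := by
    intro i
    split_ifs with h
    · simp [h]
    · calc _ ≤ ∑ k, ((if σ i = k then (1 : ℝ) else 0) + (if τ i = k then 1 else 0)) := by
            gcongr with k
            split_ifs <;> simp
        _ ≤ _ := by
            rw [Finset.sum_add_distrib]
            norm_num
  have h3 : ∑ i, ∑ k, |(if σ i = k then (1 : ℝ) else 0) - (if τ i = k then 1 else 0)| ≤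
      2 * hammingDist σ τ := by
    rw [hammingDist_cast, Finset.mul_sum]
    exact Finset.sum_le_sum fun i _ => h2 i
  refine (Finset.sum_le_sum fun k _ => h1 k).trans ?_
  rw [← Finset.mul_sum, Finset.sum_comm]
  calc _ ≤ 1 / (n : ℝ) * (2 * hammingDist σ τ) := by gcongr
    _ = _ := by ring

/-- Giving vertex `i` the same spin, here `0`, in both configurations changes the two magnetizations
by the same vector and cannot increase the Hamming distance. -/
theorem l1_offMagnetization_sub_le [NeZero q] (σ τ : Config q n) (i : Fin n) :
    l1 (offMagnetization σ i - offMagnetization τ i) ≤ 2 * hammingDist σ τ / n := by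
  have h1 : offMagnetization σ i - offMagnetization τ i =
      magnetization (Function.update σ i 0) - magnetization (Function.update τ i 0) := by
    rw [magnetization_update, magnetization_update, add_sub_add_right_eq_sub]
  have h2 := hammingDist_update σ τ i 0 0
  rw [h1]
  refine (l1_magnetization_sub_le _ _).trans ?_
  rw [h2, if_pos rfl]
  gcongr
  split_ifs <;> simp

theorem magnetization_mem_stdSimplex (hn : n ≠ 0) (σ : Config q n) :
    magnetization σ ∈ stdSimplex ℝ (Fin q) := by
  refine ⟨fun k => ?_, ?_⟩
  · exact mul_nonneg (by positivity) (Finset.sum_nonneg fun i _ => by split_ifs <;> simp)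
  · simp only [magnetization]
    rw [← Finset.mul_sum, Finset.sum_comm]
    simp [hn]

theorem sum_offMagnetization_sub (hn : n ≠ 0) (σ τ : Config q n) (i : Fin n) :
    ∑ k, (offMagnetization σ i - offMagnetization τ i) k = 0 := by
  simp [offMagnetization, Finset.sum_sub_distrib, (magnetization_mem_stdSimplex hn σ).2,
    (magnetization_mem_stdSimplex hn τ).2]

theorem l1_offMagnetization_sub_magnetization (σ : Config q n) (i : Fin n) :
    l1 (offMagnetization σ i - magnetization σ) = 1 / n := by
  rw [offMagnetization, sub_sub_cancel_left, l1_neg, l1_single, abs_of_nonneg (by positivity)]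

theorem sum_apply_eq (hn : n ≠ 0) (σ : Config q n) (φ : Fin q → ℝ) :
    ∑ i, φ (σ i) = n * ∑ k, magnetization σ k * φ k := by
  have : ∀ k, magnetization σ k * φ k = (1 / (n : ℝ)) * ∑ i, if σ i = k then φ k else 0 := by
    intro k
    rw [magnetization, mul_assoc, Finset.sum_mul]
    simp
  simp_rw [this]
  rw [← Finset.mul_sum, Finset.sum_comm, ← mul_assoc, mul_one_div_cancel (by exact_mod_cast hn),
    one_mul]
  simp

end magnetization

/-! ### The Glauber dynamics and its greedy coupling -/

section glauber

variable {q n : ℕ} (H : (Fin q → ℝ) → ℝ) (β : ℝ)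

theorem productMass_eq (ω : Config q n) : productMass ω = (1 / (q : ℝ)) ^ n := by
  simp [productMass, prior]

/-- Detailed balance: it holds vertex by vertex, because the normalizing sum of an update at `i`
does not see the spin at `i`. -/
theorem gibbsMass_mul_glauber_comm (σ τ : Config q n) :
    gibbsMass H β σ * glauber H β n σ τ = gibbsMass H β τ * glauber H β n τ σ := by
  simp only [glauber, Matrix.of_apply]
  rw [Finset.mul_sum, Finset.mul_sum]
  refine Finset.sum_congr rfl fun i _ => ?_
  have key : ∀ σ τ : Config q n, ∑ k, (if τ = Function.update σ i k then updateProb H β σ i k else 0)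
      = if τ = Function.update σ i (τ i) then updateProb H β σ i (τ i) else 0 := by
    intro σ τ
    rw [Finset.sum_eq_single (τ i)]
    · intro k _ hk
      rw [if_neg]
      intro h
      exact hk (by rw [h, Function.update_self])
    · simp
  rw [key, key]
  by_cases h : τ = Function.update σ i (τ i)
  · have h' : σ = Function.update τ i (σ i) := by
      rw [h, Function.update_idem, Function.update_eq_self]
    rw [if_pos h, if_pos h', updateProb, updateProb, ← h, ← h']
    have : ∀ l, Function.update τ i l = Function.update σ i l := by
      intro l
      rw [h, Function.update_idem]
    simp_rw [this]
    ring
  · have h' : ¬ σ = Function.update τ i (σ i) := by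
      intro h'
      apply h
      rw [h', Function.update_idem, Function.update_eq_self]
    rw [if_neg h, if_neg h']
    ring

variable [NeZero q]

theorem productMass_pos (ω : Config q n) : 0 < productMass ω := by
  have : 0 < q := Nat.pos_of_neZero q
  rw [productMass_eq]
  positivity

theorem partitionFunction_pos : 0 < partitionFunction H β n :=
  Finset.sum_pos (fun ω _ => mul_pos (Real.exp_pos _) (productMass_pos ω)) Finset.univ_nonempty

theorem gibbsMass_pos (ω : Config q n) : 0 < gibbsMass H β ω :=
  div_pos (mul_pos (Real.exp_pos _) (productMass_pos ω)) (partitionFunction_pos H β)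

theorem sum_gibbsMass : ∑ ω : Config q n, gibbsMass H β ω = 1 := by
  simp only [gibbsMass]
  rw [← Finset.sum_div]
  exact div_self (partitionFunction_pos H β).ne'

theorem sum_gibbsMass_update_pos (σ : Config q n) (i : Fin n) :
    0 < ∑ l, gibbsMass H β (Function.update σ i l) :=
  Finset.sum_pos (fun _ _ => gibbsMass_pos H β _) Finset.univ_nonempty

theorem updateProb_nonneg (σ : Config q n) (i : Fin n) (k : Fin q) : 0 ≤ updateProb H β σ i k :=
  div_nonneg (gibbsMass_pos H β _).le (sum_gibbsMass_update_pos H β σ i).le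

theorem sum_updateProb (σ : Config q n) (i : Fin n) : ∑ k, updateProb H β σ i k = 1 := by
  simp only [updateProb]
  rw [← Finset.sum_div]
  exact div_self (sum_gibbsMass_update_pos H β σ i).ne'

/-- Factoring `exp (-β n H x)` out of the Gibbs weights, with `x` the contribution of the other
spins, leaves `n (H (x + e^k / n) - H x)` in the exponent: an exact forward quotient with step
`1/n`. -/
theorem updateProb_eq_softmax (hn : n ≠ 0) (σ : Config q n) (i : Fin n) :
    updateProb H β σ i = softmax β (forwardQuotient H (1 / n) (offMagnetization σ i)) := by
  have hn' : (n : ℝ) ≠ 0 := by exact_mod_cast hn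
  funext k
  set x := offMagnetization σ i with hx
  set C : ℝ := Real.exp (-β * (n * H x)) * (1 / (q : ℝ)) ^ n / partitionFunction H β n with hC
  have hq : (0 : ℝ) < q := by exact_mod_cast Nat.pos_of_neZero q
  have hC0 : C ≠ 0 := by
    have := partitionFunction_pos H β (n := n)
    positivity
  have key : ∀ l, gibbsMass H β (Function.update σ i l) =
      C * Real.exp (-β * forwardQuotient H (1 / n) x l) := by
    intro l
    have : -β * (n * H (x + Pi.single l (1 / (n : ℝ)))) =
        -β * (n * H x) + -β * ((H (x + Pi.single l (1 / (n : ℝ))) - H x) / (1 / n)) := by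
      field_simp
      ring
    rw [gibbsMass, productMass_eq, hamiltonian, magnetization_update, ← hx, this, Real.exp_add,
      forwardQuotient, hC]
    ring
  rw [updateProb, softmax]
  simp_rw [key]
  rw [← Finset.mul_sum, mul_div_mul_left _ _ hC0]

theorem sum_glauber (hn : n ≠ 0) (σ : Config q n) : ∑ τ, glauber H β n σ τ = 1 := by
  simp only [glauber, Matrix.of_apply]
  rw [Finset.sum_comm]
  simp_rw [← Finset.mul_sum]
  have : ∀ i, ∑ τ, ∑ k, (if τ = Function.update σ i k then updateProb H β σ i k else 0) = 1 := by
    intro i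
    rw [Finset.sum_comm]
    simp [sum_updateProb]
  simp [this, hn]

theorem sum_gibbsMass_mul_glauber (hn : n ≠ 0) (τ : Config q n) :
    ∑ σ, gibbsMass H β σ * glauber H β n σ τ = gibbsMass H β τ := by
  simp_rw [gibbsMass_mul_glauber_comm H β _ τ]
  rw [← Finset.mul_sum, sum_glauber H β hn, mul_one]

/-- The greedy coupling of one step of the Glauber dynamics: the same vertex is updated in both
configurations and the two new spins are coupled maximally. -/
theorem exists_glauber_coupling (hn : n ≠ 0) :
    ∃ Q : Config q n → Config q n → Config q n → Config q n → ℝ,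
      (∀ σ τ σ' τ', 0 ≤ Q σ τ σ' τ') ∧
      (∀ σ τ σ', ∑ τ', Q σ τ σ' τ' = glauber H β n σ σ') ∧
      (∀ σ τ τ', ∑ σ', Q σ τ σ' τ' = glauber H β n τ τ') ∧
      ∀ σ τ, ∑ σ', ∑ τ', Q σ τ σ' τ' * (hammingDist σ' τ' : ℝ) =
        hammingDist σ τ - hammingDist σ τ / n +
          (1 / n) * ∑ i, tvDist (updateProb H β σ i) (updateProb H β τ i) := by
  choose m hm0 hm1 hm2 hm3 using fun (σ τ : Config q n) (i : Fin n) =>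
    exists_maximal_coupling (updateProb H β σ i) (updateProb H β τ i) (updateProb_nonneg H β σ i)
      (updateProb_nonneg H β τ i) (by rw [sum_updateProb, sum_updateProb])
  refine ⟨fun σ τ σ' τ' => ∑ i : Fin n, (1 / (n : ℝ)) * ∑ k, ∑ l,
    if σ' = Function.update σ i k ∧ τ' = Function.update τ i l then m σ τ i k l else 0,
    ?_, ?_, ?_, ?_⟩
  · intro σ τ σ' τ'
    refine Finset.sum_nonneg fun i _ => mul_nonneg (by positivity) (Finset.sum_nonneg fun k _ =>
      Finset.sum_nonneg fun l _ => ?_)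
    split_ifs
    · exact hm0 _ _ _ _ _
    · rfl
  · intro σ τ σ'
    rw [Finset.sum_comm]
    simp only [glauber, Matrix.of_apply]
    refine Finset.sum_congr rfl fun i _ => ?_
    rw [← Finset.mul_sum, Finset.sum_comm]
    congr 1
    refine Finset.sum_congr rfl fun k _ => ?_
    rw [Finset.sum_comm]
    by_cases h : σ' = Function.update σ i k
    · simp [h, hm1]
    · simp [h]
  · intro σ τ τ'
    rw [Finset.sum_comm]
    simp only [glauber, Matrix.of_apply]
    refine Finset.sum_congr rfl fun i _ => ?_
    rw [← Finset.mul_sum, Finset.sum_comm]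
    congr 1
    calc _ = ∑ k, ∑ l, if τ' = Function.update τ i l then m σ τ i k l else 0 := by
          refine Finset.sum_congr rfl fun k _ => ?_
          rw [Finset.sum_comm]
          refine Finset.sum_congr rfl fun l _ => ?_
          by_cases h : τ' = Function.update τ i l
          · simp [h]
          · simp [h]
      _ = _ := by
          rw [Finset.sum_comm]
          refine Finset.sum_congr rfl fun l _ => ?_
          by_cases h : τ' = Function.update τ i l
          · simp [h, hm2]
          · simp [h]
  · intro σ τ
    have e1 : ∑ σ', ∑ τ', (∑ i : Fin n, (1 / (n : ℝ)) * ∑ k, ∑ l,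
        if σ' = Function.update σ i k ∧ τ' = Function.update τ i l then m σ τ i k l else 0) *
          (hammingDist σ' τ' : ℝ) =
        ∑ i : Fin n, (1 / (n : ℝ)) * ∑ k, ∑ l, m σ τ i k l *
          (hammingDist (Function.update σ i k) (Function.update τ i l) : ℝ) := by
      simp_rw [Finset.sum_mul]
      rw [Finset.sum_congr rfl fun _ _ => Finset.sum_comm, Finset.sum_comm]
      refine Finset.sum_congr rfl fun i _ => ?_
      simp_rw [mul_assoc, ← Finset.mul_sum, Finset.sum_mul]
      congr 1
      rw [Finset.sum_congr rfl fun _ _ => Finset.sum_comm, Finset.sum_comm]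
      refine Finset.sum_congr rfl fun k _ => ?_
      rw [Finset.sum_congr rfl fun _ _ => Finset.sum_comm, Finset.sum_comm]
      refine Finset.sum_congr rfl fun l _ => ?_
      simp [ite_and]
    have e2 : ∀ i, ∑ k, ∑ l, m σ τ i k l *
        (hammingDist (Function.update σ i k) (Function.update τ i l) : ℝ) =
        hammingDist σ τ - (if σ i = τ i then 0 else 1) +
          tvDist (updateProb H β σ i) (updateProb H β τ i) := by
      intro i
      simp_rw [hammingDist_update, mul_add, Finset.sum_add_distrib, ← Finset.sum_mul, hm1,
        sum_updateProb, one_mul]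
      rw [← hm3]
      congr 1
      refine Finset.sum_congr rfl fun k _ => Finset.sum_congr rfl fun l _ => ?_
      split_ifs <;> simp
    rw [e1]
    simp_rw [e2]
    rw [← Finset.mul_sum, Finset.sum_add_distrib, Finset.sum_sub_distrib, ← hammingDist_cast]
    have hn' : (n : ℝ) ≠ 0 := by exact_mod_cast hn
    simp
    field_simp

end glauber

/-! ### Contraction of the update probabilities -/

section analysis

variable {q : ℕ} {H : (Fin q → ℝ) → ℝ} {β : ℝ}

theorem contDiff_softmax {m : WithTop ℕ∞} : ContDiff ℝ m (softmax β : (Fin q → ℝ) → Fin q → ℝ) := by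
  refine contDiff_pi.2 fun k => ?_
  unfold softmax
  refine ContDiff.div (by fun_prop) (by fun_prop) fun a => ?_
  exact (Finset.sum_pos (fun _ _ => Real.exp_pos _) ⟨k, Finset.mem_univ k⟩).ne'

/-- The gradient of `H` as a vector field. -/
noncomputable def gradient (H : (Fin q → ℝ) → ℝ) (z : Fin q → ℝ) (k : Fin q) : ℝ :=
  partialDeriv H k z

theorem contDiff_partialDeriv (hH : ContDiff ℝ 3 H) (k : Fin q) :
    ContDiff ℝ 2 (partialDeriv H k) := by
  unfold partialDeriv
  exact (hH.fderiv_right (m := 2) (by norm_num)).clm_apply contDiff_const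

theorem contDiff_gradient (hH : ContDiff ℝ 3 H) : ContDiff ℝ 2 (gradient H) :=
  contDiff_pi.2 fun k => contDiff_partialDeriv hH k

theorem contDiff_g (hH : ContDiff ℝ 3 H) : ContDiff ℝ 2 (g H β) :=
  contDiff_softmax.comp (contDiff_gradient hH)

/-- The fundamental theorem of calculus along `ρ`, one coordinate of `g` at a time. -/
theorem l1_g_sub_le_aggregateVariation (hH : ContDiff ℝ 3 H) {x z : Fin q → ℝ}
    {ρ : ℝ → Fin q → ℝ} (hρ : IsMonotoneCurve x z ρ) :
    l1 (g H β z - g H β x) ≤ aggregateVariation H β ρ := by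
  refine Finset.sum_le_sum fun k _ => ?_
  have hgk : ContDiff ℝ 2 (fun z => g H β z k) := contDiff_pi.1 (contDiff_g hH) k
  have hd : ContinuousOn (derivWithin ρ (Icc 0 1)) (Icc 0 1) :=
    hρ.smooth.continuousOn_derivWithin (uniqueDiffOn_Icc zero_lt_one) le_rfl
  have hcont : ContinuousOn (fun t => gradPairing H β k (ρ t) (derivWithin ρ (Icc 0 1) t))
      (Icc 0 1) := by
    unfold gradPairing
    exact ((hgk.continuous_fderiv (by norm_num)).comp_continuousOn hρ.smooth.continuousOn).clm_apply
      hd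
  have hFTC : ∫ t in (0 : ℝ)..1, gradPairing H β k (ρ t) (derivWithin ρ (Icc 0 1) t) =
      g H β (ρ 1) k - g H β (ρ 0) k := by
    refine intervalIntegral.integral_eq_sub_of_hasDerivAt_of_le (f := fun t => g H β (ρ t) k)
      zero_le_one (hgk.continuous.comp_continuousOn hρ.smooth.continuousOn) (fun t ht => ?_)
      (ContinuousOn.intervalIntegrable (by rwa [uIcc_of_le zero_le_one]))
    have h1 : HasDerivAt ρ (derivWithin ρ (Icc 0 1) t) t :=
      ((hρ.smooth.differentiableOn one_ne_zero t (Ioo_subset_Icc_self ht)).hasDerivWithinAt).hasDerivAt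
        (Icc_mem_nhds ht.1 ht.2)
    exact ((hgk.differentiable (by norm_num) (ρ t)).hasFDerivAt).comp_hasDerivAt t h1
  rw [Pi.sub_apply, ← hρ.target, ← hρ.source, ← hFTC]
  exact intervalIntegral.abs_integral_le_integral_abs zero_le_one

theorem l1_pos {z : Fin q → ℝ} (hz : z ≠ 0) : 0 < l1 z :=
  (norm_pos_iff.2 hz).trans_le (norm_le_l1 z)

theorem l1_g_sub_le (hH : ContDiff ℝ 3 H) {zβ : Fin q → ℝ} {δ : ℝ}
    {ρ : (Fin q → ℝ) → ℝ → Fin q → ℝ} (hρ : IsNeoGeodesicFamily H β zβ δ ρ)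
    {z : Fin q → ℝ} (hz : z ∈ stdSimplex ℝ (Fin q)) :
    l1 (g H β z - g H β zβ) ≤ (1 - δ / 2) * l1 (z - zβ) := by
  by_cases h : z = zβ
  · simp [h, l1]
  · obtain ⟨h1, h2⟩ := hρ z hz h
    rw [div_le_iff₀ (l1_pos (sub_ne_zero.2 h))] at h2
    exact (l1_g_sub_le_aggregateVariation hH h1).trans h2

/-- A contraction towards an interior point of the simplex is infinitesimally a contraction. -/
theorem l1_fderiv_le {G : (Fin q → ℝ) → Fin q → ℝ} {z : Fin q → ℝ}
    (hz : z ∈ stdSimplex ℝ (Fin q)) (hpos : ∀ k, 0 < z k) (hG : DifferentiableAt ℝ G z) {c : ℝ}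
    (hc : ∀ w ∈ stdSimplex ℝ (Fin q), l1 (G w - G z) ≤ c * l1 (w - z))
    {v : Fin q → ℝ} (hv : ∑ k, v k = 0) : l1 (fderiv ℝ G z v) ≤ c * l1 v := by
  have hline : HasDerivAt (fun t : ℝ => G (z + t • v)) (fderiv ℝ G z v) 0 := by
    have h1 : HasDerivAt (fun t : ℝ => z + t • v) v 0 := by
      simpa using ((hasDerivAt_id (0 : ℝ)).smul_const v).const_add z
    have h2 : HasFDerivAt G (fderiv ℝ G z) (z + (0 : ℝ) • v) := by simpa using hG.hasFDerivAt
    exact h2.comp_hasDerivAt 0 h1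
  have hlim : Tendsto (fun t : ℝ => l1 (t⁻¹ • (G (z + t • v) - G z))) (𝓝[>] 0)
      (𝓝 (l1 (fderiv ℝ G z v))) := by
    refine (continuous_l1.tendsto _).comp ?_
    simpa using hline.tendsto_slope_zero_right
  -- Interiority of `z` keeps `z + t • v` in the simplex for small `t`, so `hc` applies to it.
  have hev : ∀ᶠ t : ℝ in 𝓝[>] 0, ∀ k, 0 < z k + t * v k := by
    refine eventually_all.2 fun k => nhdsWithin_le_nhds ?_
    have : ContinuousAt (fun t : ℝ => z k + t * v k) 0 := by fun_prop
    exact this.eventually (lt_mem_nhds (by simpa using hpos k))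
  refine le_of_tendsto hlim ?_
  filter_upwards [hev, self_mem_nhdsWithin] with t ht ht0
  have ht0 : 0 < t := ht0
  have hmem : z + t • v ∈ stdSimplex ℝ (Fin q) := by
    refine ⟨fun k => by simpa using (ht k).le, ?_⟩
    simp [Finset.sum_add_distrib, ← Finset.mul_sum, hv, hz.2]
  have := hc _ hmem
  rw [add_sub_cancel_left, l1_smul, abs_of_pos ht0] at this
  rw [l1_smul, abs_of_pos (inv_pos.2 ht0), inv_mul_le_iff₀ ht0]
  linarith

theorem hasDerivAt_add_single (hH : Differentiable ℝ H) (x : Fin q → ℝ) (k : Fin q) (u : ℝ) :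
    HasDerivAt (fun u : ℝ => H (x + Pi.single k u)) (partialDeriv H k (x + Pi.single k u)) u := by
  have h1 : HasDerivAt (fun u : ℝ => x + Pi.single (M := fun _ => ℝ) k u) (Pi.single k 1) u := by
    refine HasDerivAt.const_add x (hasDerivAt_pi.2 fun l => ?_)
    by_cases h : l = k
    · subst h
      simpa using hasDerivAt_id' u
    · simpa [h] using hasDerivAt_const u (0 : ℝ)
  exact ((hH _).hasFDerivAt).comp_hasDerivAt u h1

theorem norm_single (k : Fin q) (u : ℝ) : ‖(Pi.single k u : Fin q → ℝ)‖ = |u| := by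
  refine le_antisymm ((norm_le_l1 _).trans (l1_single k u).le) ?_
  simpa using norm_le_pi_norm (Pi.single k u : Fin q → ℝ) k

theorem tendsto_add_single (z : Fin q → ℝ) (k : Fin q) :
    Tendsto (fun p : ℝ × (Fin q → ℝ) => p.2 + Pi.single k p.1) (𝓝[>] 0 ×ˢ 𝓝 z) (𝓝 z) := by
  have h1 : Continuous (fun p : ℝ × (Fin q → ℝ) => p.2 + Pi.single k p.1) := by
    have : Continuous (fun u : ℝ => (Pi.single k u : Fin q → ℝ)) :=
      continuous_single (A := fun _ : Fin q => ℝ) k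
    fun_prop
  have h2 : Tendsto (fun p : ℝ × (Fin q → ℝ) => p.2 + Pi.single k p.1) (𝓝 (0, z)) (𝓝 z) := by
    simpa using h1.tendsto (0, z)
  refine h2.mono_left ?_
  rw [nhds_prod_eq]
  exact Filter.prod_mono nhdsWithin_le_nhds le_rfl

/-- The base point moves together with the step, so strict differentiability is used, on the pair
`(x + s e^k, x)`. -/
theorem tendsto_forwardQuotient (hH : ContDiff ℝ 3 H) (z : Fin q → ℝ) :
    Tendsto (fun p : ℝ × (Fin q → ℝ) => forwardQuotient H p.1 p.2) (𝓝[>] 0 ×ˢ 𝓝 z)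
      (𝓝 (gradient H z)) := by
  refine tendsto_pi_nhds.2 fun k => ?_
  have h1 : HasStrictFDerivAt H (fderiv ℝ H z) z :=
    hH.contDiffAt.hasStrictFDerivAt (by norm_num)
  have h2 : Tendsto (fun p : ℝ × (Fin q → ℝ) => (p.2 + Pi.single k p.1, p.2))
      (𝓝[>] 0 ×ˢ 𝓝 z) (𝓝 (z, z)) := by
    rw [nhds_prod_eq]
    exact (tendsto_add_single z k).prodMk tendsto_snd
  have h3 := h1.isLittleO.comp_tendsto h2
  have h4 : Tendsto (fun p : ℝ × (Fin q → ℝ) => (forwardQuotient H p.1 p.2 k - gradient H z k))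
      (𝓝[>] 0 ×ˢ 𝓝 z) (𝓝 0) := by
    have h5 : (fun p : ℝ × (Fin q → ℝ) => H (p.2 + Pi.single k p.1) - H p.2
        - p.1 * gradient H z k) =o[𝓝[>] 0 ×ˢ 𝓝 z] fun p => p.1 := by
      refine IsLittleO.trans_isBigO (h3.congr_left fun p => ?_) (IsBigO.of_bound 1 ?_)
      · have : (Pi.single k p.1 : Fin q → ℝ) = p.1 • Pi.single k 1 := by
          rw [← Pi.single_smul, smul_eq_mul, mul_one]
        simp only [Function.comp, add_sub_cancel_left]
        rw [gradient, partialDeriv, ← smul_eq_mul, ← map_smul, ← this]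
      · exact Eventually.of_forall fun p => by simp [norm_single]
    refine h5.tendsto_div_nhds_zero.congr' ?_
    have : ∀ᶠ p : ℝ × (Fin q → ℝ) in 𝓝[>] 0 ×ˢ 𝓝 z, 0 < p.1 :=
      tendsto_fst.eventually self_mem_nhdsWithin
    filter_upwards [this] with p hp
    rw [forwardQuotient]
    field_simp
  simpa using h4.add_const (gradient H z k)

theorem tendsto_forwardQuotient_comp (hH : ContDiff ℝ 3 H) {z : Fin q → ℝ} {α : Type*}
    {l : Filter α} {s : α → ℝ} {x : α → Fin q → ℝ} (hs : Tendsto s l (𝓝[>] 0))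
    (hx : Tendsto x l (𝓝 z)) :
    Tendsto (fun a => forwardQuotient H (s a) (x a)) l (𝓝 (gradient H z)) :=
  (tendsto_forwardQuotient hH z).comp (hs.prodMk hx)

/-- The error must be small relative to `x - y`, uniformly in the step. Comparing each quotient with
the gradient separately would leave an error of order `1/n`, no smaller than `x - y` itself when the
configurations differ at a few vertices. -/
theorem isLittleO_forwardQuotient_sub (hH : ContDiff ℝ 3 H) (z : Fin q → ℝ) :
    (fun p : ℝ × (Fin q → ℝ) × (Fin q → ℝ) => forwardQuotient H p.1 p.2.1 -
      forwardQuotient H p.1 p.2.2 - fderiv ℝ (gradient H) z (p.2.1 - p.2.2))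
      =o[𝓝[>] 0 ×ˢ (𝓝 z ×ˢ 𝓝 z)] fun p => p.2.1 - p.2.2 := by
  refine isLittleO_pi.2 fun k => isLittleO_iff.2 fun η hη => ?_
  have hgrad : HasStrictFDerivAt (gradient H) (fderiv ℝ (gradient H) z) z :=
    (contDiff_gradient hH).contDiffAt.hasStrictFDerivAt (by norm_num)
  have hk := isLittleO_iff.1 (isLittleO_pi.1 hgrad.isLittleO k) hη
  rw [Metric.eventually_nhds_iff] at hk
  obtain ⟨r, hr, hk⟩ := hk
  have hs : ∀ᶠ s : ℝ in 𝓝[>] 0, s < r / 2 := nhdsWithin_le_nhds (gt_mem_nhds (by positivity))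
  have hx : ∀ᶠ x in 𝓝 z, dist x z < r / 2 := Metric.ball_mem_nhds z (by positivity)
  filter_upwards [(hs.and self_mem_nhdsWithin).prod_mk (hx.prod_mk hx)] with
    ⟨s, x, y⟩ ⟨⟨hs, hs0⟩, hx, hy⟩
  have hs0 : 0 < s := hs0
  simp only at hs hx hy ⊢
  have hdiff : Differentiable ℝ H := hH.differentiable (by norm_num)
  set a : ℝ := fderiv ℝ (gradient H) z (x - y) k with ha
  -- The mean value inequality is applied to the difference of the two segments through `x` and `y`,
  -- so that strict differentiability of the gradient bounds its derivative by `η * ‖x - y‖`.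
  have hderiv : ∀ u ∈ Icc 0 s, HasDerivWithinAt
      (fun u => H (x + Pi.single k u) - H (y + Pi.single k u) - u * a)
      (partialDeriv H k (x + Pi.single k u) - partialDeriv H k (y + Pi.single k u) - a)
      (Icc 0 s) u := by
    intro u _
    have := ((hasDerivAt_add_single hdiff x k u).sub (hasDerivAt_add_single hdiff y k u)).sub
      ((hasDerivAt_id' u).mul_const a)
    rw [one_mul] at this
    exact this.hasDerivWithinAt
  have hbound : ∀ u ∈ Ico 0 s, ‖partialDeriv H k (x + Pi.single k u) -
      partialDeriv H k (y + Pi.single k u) - a‖ ≤ η * ‖x - y‖ := by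
    intro u hu
    have hnear : ∀ w, dist w z < r / 2 → dist (w + Pi.single k u) z < r := by
      intro w hw
      have : dist (w + Pi.single k u) w = |u| := by simp [dist_eq_norm, norm_single]
      have h2 := dist_triangle (w + Pi.single k u) w z
      rw [this, abs_of_nonneg hu.1] at h2
      linarith [hu.2]
    have := hk (y := (x + Pi.single k u, y + Pi.single k u))
      (by rw [Prod.dist_eq]; exact max_lt (hnear x hx) (hnear y hy))
    simp only [add_sub_add_right_eq_sub, Pi.sub_apply] at this
    exact this
  have := norm_image_sub_le_of_norm_deriv_le_segment' hderiv hbound s (right_mem_Icc.2 hs0.le)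
  have e : forwardQuotient H s x k - forwardQuotient H s y k - a =
      s⁻¹ * (H (x + Pi.single k s) - H (y + Pi.single k s) - s * a -
        (H (x + Pi.single k 0) - H (y + Pi.single k 0) - 0 * a)) := by
    simp only [forwardQuotient, Pi.single_zero, add_zero]
    field_simp
    ring
  rw [Pi.sub_apply, Pi.sub_apply, e, norm_mul, Real.norm_of_nonneg (inv_pos.2 hs0).le,
    inv_mul_le_iff₀ hs0]
  linarith

/-- The chain rule for differences along a filter. -/
theorem _root_.HasStrictFDerivAt.isLittleO_sub_comp {α E F G : Type*} [NormedAddCommGroup E]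
    [NormedSpace ℝ E] [NormedAddCommGroup F] [NormedSpace ℝ F] [NormedAddCommGroup G]
    [NormedSpace ℝ G] {f : F → G} {B : F →L[ℝ] G} {b : F} (hf : HasStrictFDerivAt f B b)
    {l : Filter α} {u v : α → F} {w : α → E} {A : E →L[ℝ] F} (hu : Tendsto u l (𝓝 b))
    (hv : Tendsto v l (𝓝 b)) (huv : (fun p => u p - v p - A (w p)) =o[l] w) :
    (fun p => f (u p) - f (v p) - B (A (w p))) =o[l] w := by
  have hO : (fun p => u p - v p) =O[l] w := by
    refine (huv.isBigO.add (A.isBigO_comp w l)).congr_left fun p => ?_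
    abel
  have ht : Tendsto (fun p => (u p, v p)) l (𝓝 (b, b)) := by
    rw [nhds_prod_eq]
    exact hu.prodMk hv
  have h1 := (hf.isLittleO.comp_tendsto ht).trans_isBigO hO
  have h2 := (B.isBigO_comp (fun p => u p - v p - A (w p)) l).trans_isLittleO huv
  refine (h1.add h2).congr_left fun p => ?_
  simp only [Function.comp, map_sub]
  abel

theorem isLittleO_softmax_forwardQuotient_sub (hH : ContDiff ℝ 3 H) (z : Fin q → ℝ) :
    (fun p : ℝ × (Fin q → ℝ) × (Fin q → ℝ) => softmax β (forwardQuotient H p.1 p.2.1) -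
      softmax β (forwardQuotient H p.1 p.2.2) - fderiv ℝ (g H β) z (p.2.1 - p.2.2))
      =o[𝓝[>] 0 ×ˢ (𝓝 z ×ˢ 𝓝 z)] fun p => p.2.1 - p.2.2 := by
  have hB : HasStrictFDerivAt (softmax β) (fderiv ℝ (softmax β) (gradient H z)) (gradient H z) :=
    contDiff_softmax (m := 1).contDiffAt.hasStrictFDerivAt one_ne_zero
  have hgA : fderiv ℝ (g H β) z =
      (fderiv ℝ (softmax β) (gradient H z)).comp (fderiv ℝ (gradient H) z) :=
    (hB.hasFDerivAt.comp z
      (((contDiff_gradient hH).differentiable (by norm_num)) z).hasFDerivAt).fderiv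
  rw [hgA]
  refine hB.isLittleO_sub_comp ?_ ?_ (isLittleO_forwardQuotient_sub hH z)
  · exact tendsto_forwardQuotient_comp hH tendsto_fst (tendsto_fst.comp tendsto_snd)
  · exact tendsto_forwardQuotient_comp hH tendsto_fst (tendsto_snd.comp tendsto_snd)

/-- Close to a point where the tangential derivative of `g` contracts, the update probabilities
contract. -/
theorem exists_local_contraction (hH : ContDiff ℝ 3 H) {z : Fin q → ℝ} {c c' : ℝ} (hcc' : c < c')
    (hc : ∀ v : Fin q → ℝ, ∑ k, v k = 0 → l1 (fderiv ℝ (g H β) z v) ≤ c * l1 v) :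
    ∃ r > 0, ∀ s ∈ Ioo 0 r, ∀ x y : Fin q → ℝ, l1 (x - z) < r → l1 (y - z) < r →
      ∑ k, (x - y) k = 0 →
      l1 (softmax β (forwardQuotient H s x) - softmax β (forwardQuotient H s y)) ≤
        c' * l1 (x - y) := by
  -- The sup norm controls `ℓ¹` up to a factor `q`; dividing by `q + 1` also covers `q = 0`.
  have hη : 0 < (c' - c) / (q + 1) := div_pos (sub_pos.2 hcc') (by positivity)
  have h := isLittleO_iff.1 (isLittleO_softmax_forwardQuotient_sub (β := β) hH z) hη
  obtain ⟨pS, hS, pU, hU, hSU⟩ := eventually_prod_iff.1 h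
  obtain ⟨r₁, hr₁, hS⟩ := mem_nhdsGT_iff_exists_Ioo_subset.1 hS
  rw [← nhds_prod_eq] at hU
  obtain ⟨r₂, hr₂, hU⟩ := Metric.mem_nhds_iff.1 hU
  have hr₁ : 0 < r₁ := hr₁
  refine ⟨min r₁ r₂, lt_min hr₁ hr₂, fun s hs x y hx hy hxy => ?_⟩
  have hxyU : pU (x, y) := by
    refine hU ?_
    rw [Metric.mem_ball, Prod.dist_eq, dist_eq_norm, dist_eq_norm]
    exact (max_lt ((norm_le_l1 _).trans_lt hx) ((norm_le_l1 _).trans_lt hy)).trans_le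
      (min_le_right _ _)
  have hb := hSU (hS ⟨hs.1, hs.2.trans_le (min_le_left _ _)⟩) hxyU
  dsimp only at hb
  have h1 := l1_le_card_mul_norm (softmax β (forwardQuotient H s x) -
    softmax β (forwardQuotient H s y) - fderiv ℝ (g H β) z (x - y))
  have h2 := l1_add_le (softmax β (forwardQuotient H s x) -
    softmax β (forwardQuotient H s y) - fderiv ℝ (g H β) z (x - y)) (fderiv ℝ (g H β) z (x - y))
  rw [sub_add_cancel] at h2
  have h3 := hc _ hxy
  have h4 : (q : ℝ) * ((c' - c) / (q + 1) * ‖x - y‖) ≤ (c' - c) * l1 (x - y) := by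
    have e : (q : ℝ) * ((c' - c) / (q + 1) * ‖x - y‖) = (q / (q + 1)) * ((c' - c) * ‖x - y‖) := by
      field_simp
    rw [e]
    have h5 : (q : ℝ) / (q + 1) ≤ 1 := by
      rw [div_le_one (by positivity)]
      linarith
    have h6 : 0 ≤ (c' - c) * ‖x - y‖ := mul_nonneg (sub_pos.2 hcc').le (norm_nonneg _)
    calc _ ≤ (c' - c) * ‖x - y‖ := mul_le_of_le_one_left h6 h5
      _ ≤ _ := mul_le_mul_of_nonneg_left (norm_le_l1 _) (sub_pos.2 hcc').le
  have h7 := mul_le_mul_of_nonneg_left hb (Nat.cast_nonneg q : (0 : ℝ) ≤ q)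
  linarith

/-- The update probabilities converge to `g`, uniformly over the simplex. -/
theorem exists_uniform_approximation (hH : ContDiff ℝ 3 H) {η : ℝ} (hη : 0 < η) :
    ∃ r > 0, ∀ s ∈ Ioo 0 r, ∀ z ∈ stdSimplex ℝ (Fin q), ∀ x : Fin q → ℝ, l1 (x - z) ≤ s →
      l1 (softmax β (forwardQuotient H s x) - g H β z) ≤ η := by
  have key : ∀ᶠ s in 𝓝 (0 : ℝ), ∀ z ∈ stdSimplex ℝ (Fin q), 0 < s → ∀ x : Fin q → ℝ,
      l1 (x - z) ≤ s → l1 (softmax β (forwardQuotient H s x) - g H β z) ≤ η := by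
    -- Compactness of the simplex turns convergence near each `z₀` into a uniform bound.
    refine (isCompact_stdSimplex ℝ (Fin q)).eventually_forall_of_forall_eventually
      (P := fun s z => 0 < s → ∀ x : Fin q → ℝ, l1 (x - z) ≤ s →
        l1 (softmax β (forwardQuotient H s x) - g H β z) ≤ η) fun z₀ _ => ?_
    have h1 : Tendsto (fun p : ℝ × (Fin q → ℝ) => softmax β (forwardQuotient H p.1 p.2))
        (𝓝[>] 0 ×ˢ 𝓝 z₀) (𝓝 (g H β z₀)) :=
      ((contDiff_softmax (m := 1)).continuous.tendsto _).comp (tendsto_forwardQuotient hH z₀)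
    have h2 : ∀ᶠ w in 𝓝 (g H β z₀), l1 (w - g H β z₀) < η / 2 := by
      have : ContinuousAt (fun w => l1 (w - g H β z₀)) (g H β z₀) :=
        (continuous_l1.comp (continuous_id.sub continuous_const)).continuousAt
      exact this.eventually (gt_mem_nhds (by simpa [l1] using hη))
    have h3 := h1.eventually h2
    obtain ⟨pS, hS, pU, hU, hSU⟩ := eventually_prod_iff.1 h3
    obtain ⟨r₁, hr₁, hS⟩ := mem_nhdsGT_iff_exists_Ioo_subset.1 hS
    obtain ⟨r₂, hr₂, hU⟩ := Metric.mem_nhds_iff.1 hU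
    have hr₁ : 0 < r₁ := hr₁
    have h4 : ∀ᶠ z in 𝓝 z₀, l1 (g H β z - g H β z₀) < η / 2 :=
      ((contDiff_g hH).continuous.tendsto z₀).eventually h2
    have h5 : ∀ᶠ z in 𝓝 z₀, l1 (z - z₀) < r₂ / 2 := by
      have : ContinuousAt (fun w => l1 (w - z₀)) z₀ :=
        (continuous_l1.comp (continuous_id.sub continuous_const)).continuousAt
      exact this.eventually (gt_mem_nhds (by simpa [l1] using hr₂))
    have h6 : ∀ᶠ s : ℝ in 𝓝 0, s < min r₁ (r₂ / 2) :=
      gt_mem_nhds (lt_min hr₁ (by positivity))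
    rw [nhds_prod_eq]
    filter_upwards [h6.prod_mk (h4.and h5)] with ⟨s, z⟩ ⟨hs, hz1, hz2⟩
    simp only at hs hz1 hz2 ⊢
    intro hs0 x hx
    have hxz : l1 (x - z₀) < r₂ := by
      linarith [l1_sub_le x z z₀, hs.trans_le (min_le_right _ _)]
    have hxU : pU x := by
      refine hU ?_
      rw [Metric.mem_ball, dist_eq_norm]
      exact (norm_le_l1 _).trans_lt hxz
    have h7 : l1 (softmax β (forwardQuotient H s x) - g H β z₀) < η / 2 :=
      hSU (hS ⟨hs0, hs.trans_le (min_le_left _ _)⟩) hxU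
    have h8 := l1_sub_le (softmax β (forwardQuotient H s x)) (g H β z₀) (g H β z)
    rw [l1_sub_comm (g H β z₀)] at h8
    linarith
  obtain ⟨r, hr, hball⟩ := Metric.eventually_nhds_iff.1 key
  refine ⟨r, hr, fun s hs z hz x hx => hball ?_ z hz hs.1 x hx⟩
  rw [Real.dist_0_eq_abs, abs_of_pos hs.1]
  exact hs.2

/-- The update probabilities of two configurations contract when one magnetization is close to the
equilibrium macrostate. -/
theorem exists_contraction (hH : ContDiff ℝ 3 H) {zβ : Fin q → ℝ}
    (hzβ : zβ ∈ stdSimplex ℝ (Fin q)) (hpos : ∀ k, 0 < zβ k) {δ : ℝ} (hδ : δ ∈ Ioo (0 : ℝ) 1)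
    (hg : ∀ z ∈ stdSimplex ℝ (Fin q), l1 (g H β z - g H β zβ) ≤ (1 - δ / 2) * l1 (z - zβ)) :
    ∃ ε > 0, ∃ r > 0, ∀ s ∈ Ioo 0 r, ∀ z ∈ stdSimplex ℝ (Fin q), ∀ w ∈ stdSimplex ℝ (Fin q),
      l1 (w - zβ) < ε → ∀ x y : Fin q → ℝ, l1 (x - z) ≤ s → l1 (y - w) ≤ s →
      ∑ k, (x - y) k = 0 → ∀ D, l1 (z - w) ≤ D → l1 (x - y) ≤ D →
      l1 (softmax β (forwardQuotient H s x) - softmax β (forwardQuotient H s y)) ≤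
        (1 - δ / 4) * D := by
  obtain ⟨hδ0, hδ1⟩ := hδ
  obtain ⟨r, hr, hnear⟩ := exists_local_contraction (β := β) hH (c := 1 - δ / 2) (c' := 1 - δ / 4)
    (by linarith) fun v hv =>
      l1_fderiv_le hzβ hpos ((contDiff_g hH).differentiable (by norm_num) _) hg hv
  -- In the far case four errors of this size occur: two from replacing update laws by `g`, two from
  -- `l1 (w - zβ)`. Their total is `δ/4 * (r/4)`, and `D ≥ r/4` there, so the slack `δ/4 * D`
  -- absorbs them.
  have hε : 0 < δ * r / 64 := by positivity
  have hεr : δ * r / 64 < r / 64 := by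
    have := mul_lt_mul_of_pos_right hδ1 hr
    linarith
  obtain ⟨r', hr', hfar⟩ := exists_uniform_approximation (q := q) (β := β) hH hε
  refine ⟨δ * r / 64, hε, min r' (r / 2), lt_min hr' (by positivity), ?_⟩
  intro s hs z hz w hw hwε x y hx hy hxy D hD1 hD2
  have hs1 : s < r' := hs.2.trans_le (min_le_left _ _)
  have hs2 : s < r / 2 := hs.2.trans_le (min_le_right _ _)
  by_cases hzr : l1 (z - zβ) < r / 2
  · refine (hnear s ⟨hs.1, by linarith⟩ x y ?_ ?_ hxy).trans ?_
    · linarith [l1_sub_le x z zβ]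
    · linarith [l1_sub_le y w zβ]
    · gcongr
      linarith
  · push Not at hzr
    have h1 := hfar s ⟨hs.1, hs1⟩ z hz x hx
    have h2 := hfar s ⟨hs.1, hs1⟩ w hw y hy
    have h3 := hg z hz
    have h4 := hg w hw
    have h5 := l1_sub_le (softmax β (forwardQuotient H s x)) (g H β z)
      (softmax β (forwardQuotient H s y))
    have h6 := l1_sub_le (g H β z) (g H β w) (softmax β (forwardQuotient H s y))
    have h7 := l1_sub_le (g H β z) (g H β zβ) (g H β w)
    rw [l1_sub_comm (g H β w) (softmax _ _)] at h6
    rw [l1_sub_comm (g H β zβ)] at h7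
    have h8 := l1_sub_le z w zβ
    have h9 : (1 - δ / 2) * l1 (z - zβ) ≤ (1 - δ / 2) * (l1 (z - w) + l1 (w - zβ)) := by
      gcongr
      linarith
    have h10 : 0 ≤ δ / 2 * l1 (w - zβ) := mul_nonneg (by linarith) (l1_nonneg _)
    have h11 : δ / 4 * (r / 4) ≤ δ / 4 * D := by
      gcongr
      linarith
    have h12 : (1 - δ / 2) * l1 (z - w) ≤ (1 - δ / 2) * D := by
      gcongr
      linarith
    linarith

end analysis

/-! ### Minimizers of the free energy -/

section freeEnergy

variable {q : ℕ} [NeZero q] {H : (Fin q → ℝ) → ℝ} {β : ℝ}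

/-- The free energy functional, whose minimizers are the equilibrium macrostates. -/
noncomputable def freeEnergy (H : (Fin q → ℝ) → ℝ) (β : ℝ) (ν : Fin q → ℝ) : ℝ :=
  relEntropy ν + β * H ν

theorem prior_pos (k : Fin q) : 0 < prior q k := by
  have : 0 < q := Nat.pos_of_neZero q
  unfold prior
  positivity

theorem sum_prior : ∑ k, prior q k = 1 := by
  have : (q : ℝ) ≠ 0 := NeZero.ne _
  simp [prior, this]

theorem mul_log_div_eq (k : Fin q) (x : ℝ) :
    x * Real.log (x / prior q k) = prior q k * ((x / prior q k) * Real.log (x / prior q k)) := by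
  have := (prior_pos k).ne'
  field_simp

theorem continuous_relEntropy : Continuous (relEntropy : (Fin q → ℝ) → ℝ) := by
  unfold relEntropy
  refine continuous_finsetSum _ fun k _ => ?_
  simp_rw [mul_log_div_eq]
  exact continuous_const.mul (Real.continuous_mul_log.comp ((continuous_apply k).div_const _))

theorem continuous_freeEnergy (hH : Continuous H) : Continuous (freeEnergy H β) :=
  continuous_relEntropy.add (continuous_const.mul hH)

/-- The free energy has infinite inward slope at the boundary of the simplex, so that its minimizers
are interior points. -/
theorem pos_of_mem_equilibriumMacrostates (hH : Differentiable ℝ H) {z : Fin q → ℝ}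
    (hz : z ∈ equilibriumMacrostates H β) (j : Fin q) : 0 < z j := by
  obtain ⟨hmem, hmin⟩ := hz
  by_contra hj
  have hj0 : z j = 0 := le_antisymm (not_lt.1 hj) (hmem.1 j)
  set u : Fin q → ℝ := prior q with hu
  have hline : HasDerivAt (fun t : ℝ => H (z + t • (u - z))) (fderiv ℝ H z (u - z)) 0 := by
    have h1 : HasDerivAt (fun t : ℝ => z + t • (u - z)) (u - z) 0 := by
      simpa using ((hasDerivAt_id (0 : ℝ)).smul_const (u - z)).const_add z
    have h2 : HasFDerivAt H (fderiv ℝ H z) (z + (0 : ℝ) • (u - z)) := by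
      simpa using (hH z).hasFDerivAt
    exact h2.comp_hasDerivAt 0 h1
  have hslope : Tendsto (fun t : ℝ => t⁻¹ * (H (z + t • (u - z)) - H z)) (𝓝[>] 0)
      (𝓝 (fderiv ℝ H z (u - z))) := by
    simpa using hline.tendsto_slope_zero_right
  -- This expression bounds the free energy increment from `z` towards the uniform law, divided by
  -- `t`; the `log t` of the vanishing coordinate drives it to `-∞`.
  have hlim : Tendsto (fun t : ℝ => prior q j * Real.log t +
      (-relEntropy z + β * (t⁻¹ * (H (z + t • (u - z)) - H z)))) (𝓝[>] 0) atBot :=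
    (Real.tendsto_log_nhdsGT_zero.const_mul_atBot (prior_pos j)).atBot_add
      (tendsto_const_nhds.add (hslope.const_mul β))
  have hlt : ∀ᶠ t : ℝ in 𝓝[>] 0, t < 1 := nhdsWithin_le_nhds (gt_mem_nhds one_pos)
  obtain ⟨t, ht, ht1, ht0⟩ :=
    ((hlim.eventually (eventually_lt_atBot 0)).and (hlt.and self_mem_nhdsWithin)).exists
  have ht0 : 0 < t := ht0
  have hconv : z + t • (u - z) = fun k => (1 - t) * z k + t * prior q k := by
    funext k
    simp [hu]
    ring
  have hmem' : z + t • (u - z) ∈ stdSimplex ℝ (Fin q) := by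
    rw [hconv]
    refine ⟨fun k => ?_, ?_⟩
    · exact add_nonneg (mul_nonneg (by linarith) (hmem.1 k)) (mul_nonneg ht0.le (prior_pos k).le)
    · rw [Finset.sum_add_distrib, ← Finset.mul_sum, ← Finset.mul_sum, hmem.2, sum_prior]
      ring
  -- Convexity of `x log x` handles the coordinates `k ≠ j`, with no cost at the uniform law because
  -- `log 1 = 0`; coordinate `j` is computed exactly.
  have hent : relEntropy (z + t • (u - z)) ≤
      (1 - t) * relEntropy z + t * prior q j * Real.log t := by
    rw [hconv]
    have hterm : ∀ k, ((1 - t) * z k + t * prior q k) *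
        Real.log (((1 - t) * z k + t * prior q k) / prior q k) ≤
        (1 - t) * (z k * Real.log (z k / prior q k)) +
          if k = j then t * prior q j * Real.log t else 0 := by
      intro k
      have hp := prior_pos k
      split_ifs with hk
      · subst hk
        rw [hj0, mul_zero, zero_add, mul_div_assoc, div_self hp.ne']
        simp
      · rw [mul_log_div_eq, mul_log_div_eq k (z k)]
        have e : ((1 - t) * z k + t * prior q k) / prior q k =
            (1 - t) • (z k / prior q k) + t • (1 : ℝ) := by
          simp only [smul_eq_mul]
          field_simp
        have h := Real.convexOn_mul_log.2 (mem_Ici.2 (div_nonneg (hmem.1 k) hp.le))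
          (mem_Ici.2 zero_le_one) (by linarith : 0 ≤ 1 - t) ht0.le (by ring)
        rw [e]
        simp only [Real.log_one, smul_eq_mul, mul_zero, add_zero] at h ⊢
        calc _ ≤ prior q k * ((1 - t) * (z k / prior q k * Real.log (z k / prior q k))) := by
              gcongr
          _ = _ := by ring
    refine (Finset.sum_le_sum fun k _ => hterm k).trans (le_of_eq ?_)
    rw [Finset.sum_add_distrib, ← Finset.mul_sum]
    simp [relEntropy]
  have hle : relEntropy z + β * H z ≤ relEntropy (z + t • (u - z)) + β * H (z + t • (u - z)) :=
    hmin hmem'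
  have hmul := mul_lt_mul_of_pos_left ht ht0
  have e : t * (prior q j * Real.log t +
      (-relEntropy z + β * (t⁻¹ * (H (z + t • (u - z)) - H z)))) =
      t * prior q j * Real.log t - t * relEntropy z + β * (H (z + t • (u - z)) - H z) := by
    field_simp
    ring
  rw [e, mul_zero] at hmul
  linarith

/-- The free energy attains its minimum on the compact set of points at distance at least `ε` from
`zβ`; by uniqueness that minimum lies above the global one. -/
theorem exists_freeEnergy_gap (hH : Continuous H) {zβ : Fin q → ℝ}
    (hunique : equilibriumMacrostates H β = {zβ}) {ε : ℝ} (hε : 0 < ε) :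
    ∃ γ > 0, ∀ z ∈ stdSimplex ℝ (Fin q), ε ≤ l1 (z - zβ) →
      freeEnergy H β zβ + γ ≤ freeEnergy H β z := by
  have hzβ : zβ ∈ equilibriumMacrostates H β := by rw [hunique]; rfl
  set K : Set (Fin q → ℝ) := stdSimplex ℝ (Fin q) ∩ {z | ε ≤ l1 (z - zβ)}
  have hK : IsCompact K := (isCompact_stdSimplex ℝ (Fin q)).inter_right
    (isClosed_le continuous_const (continuous_l1.comp (continuous_id.sub continuous_const)))
  rcases K.eq_empty_or_nonempty with h | h
  · refine ⟨1, one_pos, fun z hz hzε => ?_⟩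
    have : z ∈ K := ⟨hz, hzε⟩
    simp [h] at this
  · obtain ⟨w, hw, hmin⟩ := hK.exists_isMinOn h (continuous_freeEnergy (β := β) hH).continuousOn
    have hlt : freeEnergy H β zβ < freeEnergy H β w := by
      refine lt_of_le_of_ne (hzβ.2 hw.1) fun heq => ?_
      have : w ∈ equilibriumMacrostates H β := by
        refine ⟨hw.1, fun x hx => ?_⟩
        have h1 : freeEnergy H β zβ ≤ freeEnergy H β x := hzβ.2 hx
        exact (heq ▸ h1 : freeEnergy H β w ≤ freeEnergy H β x)
      rw [hunique, mem_singleton_iff] at this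
      have h2 : ε ≤ l1 (w - zβ) := hw.2
      rw [this, sub_self] at h2
      simp [l1] at h2
      linarith
    refine ⟨freeEnergy H β w - freeEnergy H β zβ, sub_pos.2 hlt, fun z hz hzε => ?_⟩
    have : freeEnergy H β w ≤ freeEnergy H β z := hmin ⟨hz, hzε⟩
    linarith

end freeEnergy

/-! ### Product measures and the method of types -/

section product

variable {q n : ℕ}

theorem sum_prod_apply (z : Fin q → ℝ) : ∑ ω : Config q n, ∏ i, z (ω i) = (∑ k, z k) ^ n := by
  have := Finset.prod_univ_sum (fun _ : Fin n => (Finset.univ : Finset (Fin q))) fun _ k => z k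
  simpa [Fintype.piFinset_univ] using this.symm

theorem sum_prod_apply_mul_ite {z : Fin q → ℝ} (hz : ∑ k, z k = 1) (i : Fin n) (k : Fin q) :
    ∑ ω : Config q n, (∏ j, z (ω j)) * (if ω i = k then 1 else 0) = z k := by
  have h := Finset.prod_univ_sum (fun _ : Fin n => (Finset.univ : Finset (Fin q)))
    fun j l => z l * if j = i then (if l = k then 1 else 0) else 1
  rw [Fintype.piFinset_univ] at h
  calc _ = ∑ ω : Config q n, ∏ j, z (ω j) * (if j = i then (if ω j = k then 1 else 0) else 1) := by
        refine Finset.sum_congr rfl fun ω _ => ?_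
        rw [Finset.prod_mul_distrib, Finset.prod_ite_eq']
        simp
    _ = _ := by
        rw [← h, Finset.prod_eq_single i]
        · simp
        · intro j _ hj
          simp [hj, hz]
        · simp

theorem sum_prod_smul_magnetization {z : Fin q → ℝ} (hz : ∑ k, z k = 1) (hn : n ≠ 0) :
    ∑ ω : Config q n, (∏ j, z (ω j)) • magnetization ω = z := by
  funext k
  have hn' : (n : ℝ) ≠ 0 := by exact_mod_cast hn
  rw [Finset.sum_apply]
  simp only [Pi.smul_apply, smul_eq_mul, magnetization]
  calc _ = (1 / (n : ℝ)) * ∑ i, ∑ ω : Config q n,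
        (∏ j, z (ω j)) * (if ω i = k then 1 else 0) := by
        rw [Finset.sum_comm, Finset.mul_sum]
        refine Finset.sum_congr rfl fun ω _ => ?_
        rw [← Finset.mul_sum]
        ring
    _ = z k := by
        simp_rw [sum_prod_apply_mul_ite hz]
        simp [hn']

/-- The method of types: the maximal likelihoods of all configurations sum to at most the number of
possible magnetizations. -/
theorem sum_prod_magnetization_le (hn : n ≠ 0) :
    ∑ ω : Config q n, ∏ i, magnetization ω (ω i) ≤ ((n : ℝ) + 1) ^ q := by
  -- The `ζ m` include every possible magnetization; there are `(n + 1) ^ q` of them, and each that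
  -- sums to one defines a product law of total mass one.
  set ζ : (Fin q → Fin (n + 1)) → Fin q → ℝ := fun m k => (m k : ℝ) / n with hζ
  have hζ0 : ∀ m k, 0 ≤ ζ m k := fun m k => by positivity
  have h1 : ∀ ω : Config q n, ∏ i, magnetization ω (ω i) ≤
      ∑ m, if ∑ k, ζ m k = 1 then ∏ i, ζ m (ω i) else 0 := by
    intro ω
    set m : Fin q → Fin (n + 1) := fun k => ⟨(Finset.univ.filter fun i => ω i = k).card,
      Nat.lt_succ_of_le ((Finset.card_le_univ _).trans (by simp))⟩
    have hm : ζ m = magnetization ω := by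
      funext k
      simp [hζ, m, magnetization, div_eq_inv_mul]
    have h2 := Finset.single_le_sum (f := fun m => if ∑ k, ζ m k = 1 then ∏ i, ζ m (ω i) else 0)
      (fun m _ => by
        split_ifs
        · exact Finset.prod_nonneg fun i _ => hζ0 _ _
        · exact le_rfl) (Finset.mem_univ m)
    simpa only [hm, (magnetization_mem_stdSimplex hn ω).2, if_true] using h2
  calc _ ≤ ∑ ω : Config q n, ∑ m, if ∑ k, ζ m k = 1 then ∏ i, ζ m (ω i) else 0 :=
        Finset.sum_le_sum fun ω _ => h1 ω
    _ = ∑ m, ∑ ω : Config q n, if ∑ k, ζ m k = 1 then ∏ i, ζ m (ω i) else 0 := Finset.sum_comm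
    _ ≤ ∑ _m : Fin q → Fin (n + 1), (1 : ℝ) := by
        refine Finset.sum_le_sum fun m _ => ?_
        split_ifs with h
        · rw [sum_prod_apply, h, one_pow]
        · simp
    _ = _ := by simp

theorem magnetization_apply_pos (ω : Config q n) (i : Fin n) : 0 < magnetization ω (ω i) := by
  have hn : 0 < n := i.pos
  refine mul_pos (by positivity) ?_
  refine lt_of_lt_of_le one_pos ?_
  have := Finset.single_le_sum (f := fun j => if ω j = ω i then (1 : ℝ) else 0)
    (fun j _ => by split_ifs <;> simp) (Finset.mem_univ i)
  simpa using this

end product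

/-! ### Large deviations of the magnetization -/

section largeDeviations

variable {q n : ℕ} [NeZero q] {H : (Fin q → ℝ) → ℝ} {β : ℝ}

/-- Change of measure from the uniform law to `z`. Positivity is asked only at spin values occurring
in `ω`, so that `z` may be the magnetization of `ω` itself. -/
theorem productMass_eq_exp (hn : n ≠ 0) (ω : Config q n) {z : Fin q → ℝ}
    (hz : ∀ i, 0 < z (ω i)) :
    productMass ω = (∏ i, z (ω i)) *
      Real.exp (-(n * ∑ k, magnetization ω k * Real.log (z k / prior q k))) := by
  rw [← sum_apply_eq hn ω fun k => Real.log (z k / prior q k), ← Finset.sum_neg_distrib,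
    Real.exp_sum, ← Finset.prod_mul_distrib, productMass]
  refine Finset.prod_congr rfl fun i _ => ?_
  have h1 := prior_pos (ω i)
  have h2 := hz i
  rw [← Real.log_inv, Real.exp_log (by positivity)]
  field_simp

/-- Write the partition function as an expectation under the product law with marginal `z`, under
which the magnetization has mean `z`. Jensen for `exp` moves the expectation into the exponent, and
concavity of `H` bounds the mean of `H (magnetization ω)` by `H z`. -/
theorem exp_neg_freeEnergy_le_partitionFunction (hconcave : ConcaveOn ℝ univ H) (hβ : 0 ≤ β)
    (hn : n ≠ 0) {z : Fin q → ℝ} (hz : z ∈ stdSimplex ℝ (Fin q)) (hpos : ∀ k, 0 < z k) :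
    Real.exp (-(n * freeEnergy H β z)) ≤ partitionFunction H β n := by
  set c : Fin q → ℝ := fun k => Real.log (z k / prior q k) with hc
  set w : Config q n → ℝ := fun ω => ∏ j, z (ω j) with hw
  have hw0 : ∀ ω ∈ (Finset.univ : Finset (Config q n)), 0 ≤ w ω :=
    fun ω _ => Finset.prod_nonneg fun i _ => (hpos _).le
  have hw1 : ∑ ω, w ω = 1 := by rw [hw, sum_prod_apply, hz.2, one_pow]
  have hmean : ∑ ω, w ω • magnetization ω = z := sum_prod_smul_magnetization hz.2 hn
  have hZ : partitionFunction H β n = ∑ ω, w ω • Real.exp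
      (-(n * ((∑ k, magnetization ω k * c k) + β * H (magnetization ω)))) := by
    refine Finset.sum_congr rfl fun ω _ => ?_
    rw [productMass_eq_exp hn ω fun i => hpos (ω i), hamiltonian, smul_eq_mul, mul_comm,
      mul_assoc, ← Real.exp_add]
    congr 2
    ring
  have hJ := convexOn_exp.map_sum_le (p := fun ω : Config q n =>
    -(n * ((∑ k, magnetization ω k * c k) + β * H (magnetization ω)))) hw0 hw1
    fun _ _ => mem_univ _
  have hHJ := hconcave.le_map_sum (p := fun ω : Config q n => magnetization ω) hw0 hw1
    fun _ _ => mem_univ _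
  rw [hmean] at hHJ
  have hlin : ∑ ω, w ω * ∑ k, magnetization ω k * c k = relEntropy z := by
    calc _ = ∑ k, (∑ ω, w ω • magnetization ω) k * c k := by
          simp_rw [Finset.sum_apply, Finset.sum_mul, Finset.mul_sum]
          rw [Finset.sum_comm]
          simp [mul_assoc]
      _ = _ := by rw [hmean]; rfl
  rw [hZ]
  refine le_trans (Real.exp_le_exp.2 ?_) hJ
  have e : ∑ ω, w ω • (-(n * ((∑ k, magnetization ω k * c k) + β * H (magnetization ω)))) =
      -(n * (relEntropy z + β * ∑ ω, w ω • H (magnetization ω))) := by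
    rw [← hlin, Finset.mul_sum, ← Finset.sum_add_distrib, Finset.mul_sum, ← Finset.sum_neg_distrib]
    refine Finset.sum_congr rfl fun ω _ => ?_
    simp only [smul_eq_mul]
    ring
  rw [e, freeEnergy]
  gcongr

/-- Large deviations upper bound for the magnetization under the Gibbs measure. -/
theorem exists_gibbsMass_far_le (hH : Continuous H) (hconcave : ConcaveOn ℝ univ H) (hβ : 0 ≤ β)
    {zβ : Fin q → ℝ} (hunique : equilibriumMacrostates H β = {zβ}) (hpos : ∀ k, 0 < zβ k) {ε : ℝ}
    (hε : 0 < ε) :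
    ∃ γ > 0, ∀ n : ℕ, n ≠ 0 →
      ∑ ω : Config q n, (if l1 (magnetization ω - zβ) < ε then 0 else gibbsMass H β ω) ≤
        ((n : ℝ) + 1) ^ q * Real.exp (-(γ * n)) := by
  have hzβ : zβ ∈ equilibriumMacrostates H β := by rw [hunique]; rfl
  obtain ⟨γ, hγ, hgap⟩ := exists_freeEnergy_gap (β := β) hH hunique hε
  refine ⟨γ, hγ, fun n hn => ?_⟩
  have hZ := exp_neg_freeEnergy_le_partitionFunction hconcave hβ hn hzβ.1 hpos
  have hZ0 := partitionFunction_pos H β (n := n)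
  have hterm : ∀ ω : Config q n,
      (if l1 (magnetization ω - zβ) < ε then 0 else gibbsMass H β ω) ≤
        (∏ i, magnetization ω (ω i)) * Real.exp (-(γ * n)) := by
    intro ω
    have hprod : 0 ≤ ∏ i, magnetization ω (ω i) :=
      Finset.prod_nonneg fun i _ => (magnetization_apply_pos ω i).le
    split_ifs with h
    · positivity
    · have hF := hgap _ (magnetization_mem_stdSimplex hn ω) (not_lt.1 h)
      -- Tilting by the magnetization of `ω` itself turns the uniform mass into the maximal
      -- likelihood times `exp (-n * relEntropy)`, so the free energy of the magnetization appears.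
      rw [gibbsMass, div_le_iff₀ hZ0, productMass_eq_exp hn ω (magnetization_apply_pos ω),
        hamiltonian, mul_comm, mul_assoc, mul_assoc, ← Real.exp_add]
      refine mul_le_mul_of_nonneg_left ?_ hprod
      refine le_trans ?_ (mul_le_mul_of_nonneg_left hZ (Real.exp_pos _).le)
      rw [← Real.exp_add, Real.exp_le_exp]
      have h2 := mul_le_mul_of_nonneg_left hF (Nat.cast_nonneg n : (0 : ℝ) ≤ n)
      rw [freeEnergy, freeEnergy, relEntropy, relEntropy] at h2
      rw [freeEnergy, relEntropy]
      linarith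
  calc _ ≤ ∑ ω : Config q n, (∏ i, magnetization ω (ω i)) * Real.exp (-(γ * n)) :=
        Finset.sum_le_sum fun ω _ => hterm ω
    _ ≤ _ := by
        rw [← Finset.sum_mul]
        gcongr
        exact sum_prod_magnetization_le hn

end largeDeviations

/-! ### From contraction to the mixing time -/

section mixing

variable {q : ℕ} {H : (Fin q → ℝ) → ℝ} {β : ℝ}

/-- The distance is Hamming, of diameter at most `n`. The common bound `D = 2 * hammingDist σ τ / n`
controls both the magnetizations and the off-magnetizations; the `1/2` in total variation cancels
its factor `2`. -/
theorem maxDist_le [NeZero q] {zβ : Fin q → ℝ} {n : ℕ} (hn : n ≠ 0) {c ε r : ℝ} (hc0 : 0 ≤ c)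
    (hc1 : c ≤ 1) (hr : 1 / (n : ℝ) < r)
    (hcontr : ∀ s ∈ Ioo 0 r, ∀ z ∈ stdSimplex ℝ (Fin q), ∀ w ∈ stdSimplex ℝ (Fin q),
      l1 (w - zβ) < ε → ∀ x y : Fin q → ℝ, l1 (x - z) ≤ s → l1 (y - w) ≤ s →
      ∑ k, (x - y) k = 0 → ∀ D, l1 (z - w) ≤ D → l1 (x - y) ≤ D →
      l1 (softmax β (forwardQuotient H s x) - softmax β (forwardQuotient H s y)) ≤ (1 - c) * D)
    (t : ℕ) :
    maxDist H β n t ≤ (1 - c / n) ^ t * n + t * (n *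
      ∑ ω : Config q n, (if l1 (magnetization ω - zβ) < ε then 0 else gibbsMass H β ω)) := by
  classical
  have hn0 : (0 : ℝ) < n := by exact_mod_cast Nat.pos_of_ne_zero hn
  have hn1 : (1 : ℝ) ≤ n := by exact_mod_cast Nat.one_le_iff_ne_zero.2 hn
  obtain ⟨Q, hQ0, hQ1, hQ2, hQd⟩ := exists_glauber_coupling H β hn
  refine ciSup_le fun σ₀ => ?_
  refine tvDist_pow_le_of_contraction (glauber H β n) (gibbsMass H β)
    (fun ω => (gibbsMass_pos H β ω).le) (sum_gibbsMass H β) (sum_gibbsMass_mul_glauber H β hn)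
    (fun σ τ => (hammingDist σ τ : ℝ)) n (c / n) (fun _ _ => Nat.cast_nonneg _) ?_ ?_
    (by positivity) ?_ {ω | l1 (magnetization ω - zβ) < ε} Q hQ0 hQ1 hQ2 (sum_glauber H β hn)
    ?_ σ₀ t
  · intro σ τ hστ
    exact_mod_cast hammingDist_pos.2 hστ
  · intro σ τ
    exact_mod_cast hammingDist_le_card_fintype.trans (by simp)
  · rw [div_le_one hn0]
    linarith
  · intro σ τ hτ
    rw [hQd]
    have htv : ∀ i, tvDist (updateProb H β σ i) (updateProb H β τ i) ≤
        (1 - c) * (hammingDist σ τ / n) := by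
      intro i
      have h := hcontr (1 / n) ⟨by positivity, hr⟩ _ (magnetization_mem_stdSimplex hn σ) _
        (magnetization_mem_stdSimplex hn τ) hτ (offMagnetization σ i) (offMagnetization τ i)
        (l1_offMagnetization_sub_magnetization σ i).le
        (l1_offMagnetization_sub_magnetization τ i).le (sum_offMagnetization_sub hn σ τ i) _
        (l1_magnetization_sub_le σ τ) (l1_offMagnetization_sub_le σ τ i)
      rw [← updateProb_eq_softmax H β hn, ← updateProb_eq_softmax H β hn] at h
      have e : tvDist (updateProb H β σ i) (updateProb H β τ i) =
          1 / 2 * l1 (updateProb H β σ i - updateProb H β τ i) := rfl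
      rw [e]
      calc _ ≤ 1 / 2 * ((1 - c) * (2 * hammingDist σ τ / n)) := by gcongr
        _ = _ := by ring
    have hsum := Finset.sum_le_sum fun i (_ : i ∈ Finset.univ) => htv i
    simp only [Finset.sum_const, Finset.card_univ, Fintype.card_fin, nsmul_eq_mul] at hsum
    calc _ ≤ (hammingDist σ τ : ℝ) - hammingDist σ τ / n +
          1 / n * (n * ((1 - c) * (hammingDist σ τ / n))) := by gcongr
      _ = _ := by
          field_simp
          ring

theorem tendsto_pow_mul_exp_neg (k : ℕ) {γ : ℝ} (hγ : 0 < γ) :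
    Tendsto (fun n : ℕ => ((n : ℝ) + 1) ^ k * Real.exp (-(γ * n))) atTop (𝓝 0) := by
  have h1 : Tendsto (fun n : ℕ => (n : ℝ) + 1) atTop atTop :=
    tendsto_atTop_add_const_right _ _ tendsto_natCast_atTop_atTop
  have h2 := ((isLittleO_pow_exp_pos_mul_atTop (k := k) hγ).tendsto_div_nhds_zero.comp h1).const_mul
    (Real.exp γ)
  rw [mul_zero] at h2
  refine h2.congr fun n => ?_
  have e : Real.exp (γ * (n + 1)) = Real.exp γ * Real.exp (γ * n) := by
    rw [← Real.exp_add]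
    congr 1
    ring
  simp only [Function.comp]
  rw [e, Real.exp_neg]
  field_simp

/-- A geometric decay at rate `c / n` per step, up to an exponentially small error per step, makes
the distance small after order `n log n` steps. -/
theorem exists_mixing_bound {d : ℕ → ℕ → ℝ} {c γ : ℝ} (hc0 : 0 < c) (hc1 : c ≤ 1) (hγ : 0 < γ)
    (k : ℕ) (hd : ∀ᶠ n : ℕ in atTop, ∀ t : ℕ, d n t ≤
      (1 - c / n) ^ t * n + t * (n * (((n : ℝ) + 1) ^ k * Real.exp (-(γ * n))))) {ε : ℝ}
    (hε : 0 < ε) :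
    ∀ᶠ n : ℕ in atTop, ∃ t : ℕ, d n t ≤ ε ∧ (t : ℝ) ≤ (2 / c + 1) * (n * Real.log n) := by
  have h1 : Tendsto (fun n : ℕ => (n : ℝ)⁻¹) atTop (𝓝 0) := tendsto_inv_atTop_nhds_zero_nat
  have h2 : Tendsto (fun n : ℕ => (2 / c + 1) *
      (((n : ℝ) + 1) ^ (3 + k) * Real.exp (-(γ * n)))) atTop (𝓝 0) := by
    simpa using (tendsto_pow_mul_exp_neg (3 + k) hγ).const_mul (2 / c + 1)
  filter_upwards [hd, h1.eventually (gt_mem_nhds (half_pos hε)),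
    h2.eventually (gt_mem_nhds (half_pos hε)), eventually_ge_atTop 3] with n hdn hn1 hn2 hn3
  have hn3' : (3 : ℝ) ≤ n := by exact_mod_cast hn3
  have hn0 : (0 : ℝ) < n := by linarith
  have hlog1 : 1 ≤ Real.log n := by
    rw [Real.le_log_iff_exp_le hn0]
    linarith [Real.exp_one_lt_d9]
  have hlogn : Real.log n ≤ n := (Real.log_le_sub_one_of_pos hn0).trans (by linarith)
  have hx0 : 0 ≤ 2 / c * (n * Real.log n) := by positivity
  -- With this `t`, `(1 - c/n)^t ≤ n⁻²`, which leaves `n⁻¹` after multiplication by the diameter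
  -- `n`. Rounding up costs at most `n log n`, since `n ≥ 3` gives `log n ≥ 1`.
  set t : ℕ := ⌈2 / c * (n * Real.log n)⌉₊ with ht
  have ht1 : 2 / c * (n * Real.log n) ≤ t := Nat.le_ceil _
  have ht2 : (t : ℝ) ≤ (2 / c + 1) * (n * Real.log n) := by
    have h3 := (Nat.ceil_lt_add_one hx0).le
    have h4 : 1 ≤ (n : ℝ) * Real.log n := one_le_mul_of_one_le_of_one_le (by linarith) hlog1
    rw [add_mul, one_mul]
    linarith
  refine ⟨t, (hdn t).trans ?_, ht2⟩
  have hfirst : (1 - c / n) ^ t * n ≤ (n : ℝ)⁻¹ := by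
    have h0 : 0 ≤ 1 - c / n := by
      rw [sub_nonneg, div_le_one hn0]
      linarith
    have h3 : (1 - c / n) ^ t ≤ Real.exp (-(2 * Real.log n)) := by
      calc (1 - c / n) ^ t ≤ Real.exp (-(c / n)) ^ t :=
            pow_le_pow_left₀ h0 (Real.one_sub_le_exp_neg _) t
        _ = Real.exp (t * -(c / n)) := (Real.exp_nat_mul _ _).symm
        _ ≤ _ := by
            rw [Real.exp_le_exp]
            have := mul_le_mul_of_nonneg_right ht1 (show 0 ≤ c / n by positivity)
            have e : 2 / c * (n * Real.log n) * (c / n) = 2 * Real.log n := by field_simp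
            linarith
    have h4 : Real.exp (-(2 * Real.log n)) = (n : ℝ)⁻¹ * (n : ℝ)⁻¹ := by
      rw [two_mul, neg_add, Real.exp_add, Real.exp_neg, Real.exp_log hn0]
    calc _ ≤ (n : ℝ)⁻¹ * (n : ℝ)⁻¹ * n := by
          rw [← h4]
          gcongr
      _ = _ := by field_simp
  have hsecond : t * (n * (((n : ℝ) + 1) ^ k * Real.exp (-(γ * n)))) ≤
      (2 / c + 1) * (((n : ℝ) + 1) ^ (3 + k) * Real.exp (-(γ * n))) := by
    calc _ ≤ (2 / c + 1) * (((n : ℝ) + 1) * ((n : ℝ) + 1)) *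
          (((n : ℝ) + 1) * (((n : ℝ) + 1) ^ k * Real.exp (-(γ * n)))) := by
          gcongr
          · refine ht2.trans ?_
            gcongr
            · linarith
            · linarith
          · linarith
      _ = _ := by ring
  linarith

end mixing

end MeanFieldGibbs

theorem theorem9p2 {q : ℕ} (H : (Fin q → ℝ) → ℝ) (hsmooth : ContDiff ℝ 3 H)
    (hconcave : ConcaveOn ℝ univ H)
    (hseparable : ∃ h : Fin q → ℝ → ℝ, ∀ z, H z = ∑ k, h k (z k))
    (β : ℝ) (hβ : 0 < β) (zβ : Fin q → ℝ) (hunique : equilibriumMacrostates H β = {zβ})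
    (hRS : ConditionRS H β zβ) (hlocal : ConditionLocalBound H β zβ) :
    ∀ ε : ℝ, 0 < ε →
      (∀ᶠ n : ℕ in atTop, ∃ t, maxDist H β n t ≤ ε) ∧
      (fun n : ℕ => (mixingTime H β ε n : ℝ)) =O[atTop] fun n : ℕ => (n : ℝ) * Real.log n := by

  intro ε hε
  have hzβ : zβ ∈ equilibriumMacrostates H β := by rw [hunique]; rfl
  -- For `q = 0` the simplex is empty, as the empty sum is not `1`.
  have : NeZero q := by
    refine ⟨?_⟩
    rintro rfl
    simpa using hzβ.1.2
  obtain ⟨δ, hδ, ε₀, hε₀, hfam⟩ := hRS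
  -- Any scale below `ε₀` serves, since `δ` does not depend on it.
  obtain ⟨ρ, hρ, -⟩ := hfam (ε₀ / 2) ⟨by positivity, by linarith⟩
  have hpos := pos_of_mem_equilibriumMacrostates (hsmooth.differentiable (by norm_num)) hzβ
  obtain ⟨ε₁, hε₁, r, hr, hcontr⟩ := exists_contraction (β := β) hsmooth hzβ.1 hpos hδ
    fun z hz => l1_g_sub_le hsmooth hρ hz
  obtain ⟨γ, hγ, hfar⟩ := exists_gibbsMass_far_le hsmooth.continuous hconcave hβ.le hunique hpos hε₁
  have hd : ∀ᶠ n : ℕ in atTop, ∀ t : ℕ, maxDist H β n t ≤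
      (1 - δ / 4 / n) ^ t * n + t * (n * (((n : ℝ) + 1) ^ q * Real.exp (-(γ * n)))) := by
    filter_upwards [tendsto_one_div_atTop_nhds_zero_nat.eventually (gt_mem_nhds hr),
      eventually_ne_atTop 0] with n hn hn0 t
    refine (maxDist_le hn0 (by linarith [hδ.1]) (by linarith [hδ.2]) hn hcontr t).trans ?_
    gcongr
    exact hfar n hn0
  have hmix := exists_mixing_bound (by linarith [hδ.1]) (by linarith [hδ.2]) hγ q hd hε
  refine ⟨hmix.mono fun n ⟨t, ht, _⟩ => ⟨t, ht⟩, IsBigO.of_bound (2 / (δ / 4) + 1) ?_⟩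
  filter_upwards [hmix] with n ⟨t, ht, htn⟩
  have h1 : mixingTime H β ε n ≤ t := Nat.sInf_le ht
  have h2 : (mixingTime H β ε n : ℝ) ≤ t := by exact_mod_cast h1
  have h3 : 0 ≤ (n : ℝ) * Real.log n := mul_nonneg (Nat.cast_nonneg n) (Real.log_natCast_nonneg n)
  rw [Real.norm_of_nonneg (Nat.cast_nonneg _), Real.norm_of_nonneg h3]
  exact h2.trans htn
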